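/- Let $D=\{z\in\mathbb{C}:|z|<1\}$ and let $H^2(D)$ be the Hardy space of analytic functions $f$ on $D$ with $\|f\|^2=\sup_{0<r<1}\frac{1}{2\pi}\int_0^{2\pi}|f(re^{i\theta})|^2\,d\theta<\infty$, a Hilbert space with inner product $\langle f,g\rangle=\lim_{r\to1^-}\frac{1}{2\pi}\int_0^{2\pi}f(re^{i\theta})\overline{g(re^{i\theta})}\,d\theta$. For an analytic map $\varphi:D\to D$ let $C_\varphi f=f\circ\varphi$, a bounded operator on $H^2(D)$. A bounded operator $T$ on a complex Hilbert space $\mathcal{H}$ is called complex symmetric if $T=CT^*C$ for some map $C:\mathcal{H}\to\mathcal{H}$ that is conjugate-linear, satisfies $\langle Cx,Cy\rangle=\langle y,x\rangle$ for all $x,y\in\mathcal{H}$, and satisfies $C^2=I$. Theorem 4.1. Let $\varphi(z)=\frac{\alpha z+\beta}{\gamma z+\delta}$ with $\alpha\delta-\beta\gamma\neq0$ be a linear fractional transformation that maps $D$ into $D$, is not an automorphism of $D$, and fixes some $a\in D\setminus\{0\}$. If $C_\varphi$ is complex symmetric on $H^2(D)$, then $\varphi(\infty)=\infty$ and $\varphi$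 is a polynomial of degree one in $z$. -/

import Mathlib

/-! # The Hardy space `H²(D)` of the unit disc and composition operators on it -/

namespace HardyDisc

open Complex Metric Set Filter Topology
open scoped ComplexConjugate

/-! ### The underlying vector space -/

/-- The mean value `(1/2π) ∫₀^{2π} |f(r e^{iθ})|² dθ`. -/
noncomputable def meanSq (f : ℂ → ℂ) (r : ℝ) : ℝ :=
  Real.circleAverage (fun z => ‖f z‖ ^ 2) 0 r

theorem mem_ball_circleMap {r : ℝ} (h0 : 0 ≤ r) (h1 : r < 1) (θ : ℝ) :
    circleMap 0 r θ ∈ ball (0 : ℂ) 1 := by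
  simp [abs_of_nonneg h0, h1]

theorem continuous_comp_circleMap {f : ℂ → ℂ} (hf : DifferentiableOn ℂ f (ball 0 1)) {r : ℝ}
    (h0 : 0 ≤ r) (h1 : r < 1) : Continuous fun θ : ℝ => f (circleMap 0 r θ) :=
  hf.continuousOn.comp_continuous (continuous_circleMap 0 r) (mem_ball_circleMap h0 h1)

theorem circleIntegrable_normSq {f : ℂ → ℂ} (hf : DifferentiableOn ℂ f (ball 0 1)) {r : ℝ}
    (h0 : 0 ≤ r) (h1 : r < 1) : CircleIntegrable (fun z => ‖f z‖ ^ 2) 0 r :=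
  ((continuous_comp_circleMap hf h0 h1).norm.pow 2).intervalIntegrable _ _

theorem meanSq_add_le {f g : ℂ → ℂ} (hf : DifferentiableOn ℂ f (ball 0 1))
    (hg : DifferentiableOn ℂ g (ball 0 1)) {r : ℝ} (h0 : 0 ≤ r) (h1 : r < 1) :
    meanSq (f + g) r ≤ 2 * meanSq f r + 2 * meanSq g r := by
  have e1 : 2 * meanSq f r = Real.circleAverage (fun z => (2 : ℝ) * ‖f z‖ ^ 2) 0 r := by
    simpa [meanSq] using
      (Real.circleAverage_fun_smul (a := (2 : ℝ)) (f := fun z => ‖f z‖ ^ 2) (c := 0) (R := r)).symm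
  have e2 : 2 * meanSq g r = Real.circleAverage (fun z => (2 : ℝ) * ‖g z‖ ^ 2) 0 r := by
    simpa [meanSq] using
      (Real.circleAverage_fun_smul (a := (2 : ℝ)) (f := fun z => ‖g z‖ ^ 2) (c := 0) (R := r)).symm
  have i1 : CircleIntegrable (fun z => (2 : ℝ) * ‖f z‖ ^ 2) 0 r :=
    (circleIntegrable_normSq hf h0 h1).const_mul 2
  have i2 : CircleIntegrable (fun z => (2 : ℝ) * ‖g z‖ ^ 2) 0 r :=
    (circleIntegrable_normSq hg h0 h1).const_mul 2
  rw [e1, e2, ← Real.circleAverage_fun_add i1 i2]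
  refine Real.circleAverage_mono (circleIntegrable_normSq (hf.add hg) h0 h1) (i1.add i2) ?_
  intro z _
  have := norm_add_le (f z) (g z)
  have h3 := norm_nonneg (f z + g z)
  simp only [Pi.add_apply]
  nlinarith [sq_nonneg (‖f z‖ - ‖g z‖)]

/-- The functions that are analytic on the unit disc and satisfy
`sup_{0<r<1} (1/2π) ∫₀^{2π} |f(r e^{iθ})|² dθ < ∞`. A function on the disc is represented by its
extension by zero to `ℂ`. -/
noncomputable def hardySubmodule : Submodule ℂ (ℂ → ℂ) where
  carrier := {f | DifferentiableOn ℂ f (ball 0 1) ∧ (∀ z ∉ ball (0 : ℂ) 1, f z = 0) ∧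
    BddAbove (meanSq f '' Ioo 0 1)}
  zero_mem' := by
    refine ⟨differentiableOn_const 0, fun z _ => rfl, 0, ?_⟩
    rintro _ ⟨r, _, rfl⟩
    simp [meanSq, Real.circleAverage_const]
  add_mem' := by
    rintro f g ⟨hf, hf0, M, hM⟩ ⟨hg, hg0, N, hN⟩
    refine ⟨hf.add hg, fun z hz => by simp [hf0 z hz, hg0 z hz], 2 * M + 2 * N, ?_⟩
    rintro _ ⟨r, hr, rfl⟩
    have h1 := hM ⟨r, hr, rfl⟩
    have h2 := hN ⟨r, hr, rfl⟩
    have h3 := meanSq_add_le hf hg hr.1.le hr.2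
    linarith
  smul_mem' := by
    rintro c f ⟨hf, hf0, M, hM⟩
    refine ⟨hf.const_smul c, fun z hz => by simp [hf0 z hz], ‖c‖ ^ 2 * M, ?_⟩
    rintro _ ⟨r, hr, rfl⟩
    have h1 := hM ⟨r, hr, rfl⟩
    have : meanSq (c • f) r = ‖c‖ ^ 2 * meanSq f r := by
      simpa [meanSq, mul_pow] using (Real.circleAverage_fun_smul (a := ‖c‖ ^ 2)
        (f := fun z => ‖f z‖ ^ 2) (c := 0) (R := r))
    rw [this]
    gcongr

/-- The Hardy space `H²(D)`. -/
def H2 : Type := hardySubmodule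

namespace H2

noncomputable instance : AddCommGroup H2 := inferInstanceAs (AddCommGroup hardySubmodule)

noncomputable instance : Module ℂ H2 := inferInstanceAs (Module ℂ hardySubmodule)

instance : CoeFun H2 fun _ => ℂ → ℂ := ⟨fun f => f.1⟩

theorem differentiableOn (f : H2) : DifferentiableOn ℂ f (ball 0 1) := f.2.1

theorem apply_eq_zero (f : H2) {z : ℂ} (hz : z ∉ ball (0 : ℂ) 1) : f z = 0 := f.2.2.1 z hz

theorem bddAbove (f : H2) : BddAbove (meanSq f '' Ioo 0 1) := f.2.2.2

theorem add_apply (f g : H2) (z : ℂ) : (f + g) z = f z + g z := rfl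

theorem smul_apply (c : ℂ) (f : H2) (z : ℂ) : (c • f) z = c * f z := rfl

theorem ext {f g : H2} (h : ∀ z ∈ ball (0 : ℂ) 1, f z = g z) : f = g := by
  refine Subtype.ext (funext fun z => ?_)
  by_cases hz : z ∈ ball (0 : ℂ) 1
  · exact h z hz
  · exact (apply_eq_zero f hz).trans (apply_eq_zero g hz).symm

end H2

/-! ### Taylor coefficients and Parseval's identity -/

/-- The `n`-th Taylor coefficient at `0`. -/
noncomputable def taylorCoeff (f : ℂ → ℂ) (n : ℕ) : ℂ :=
  (n.factorial : ℂ)⁻¹ * iteratedDeriv n f 0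

theorem hasSum_taylorCoeff {f : ℂ → ℂ} (hf : DifferentiableOn ℂ f (ball 0 1)) {z : ℂ}
    (hz : z ∈ ball (0 : ℂ) 1) : HasSum (fun n => taylorCoeff f n * z ^ n) (f z) := by
  have := Complex.hasSum_taylorSeries_on_ball hf hz
  refine this.congr_fun ?_ |> fun h => h
  intro n
  simp [taylorCoeff]; ring

theorem circleAverage_conj_pow_mul {f : ℂ → ℂ} (hf : DifferentiableOn ℂ f (ball 0 1)) {r : ℝ}
    (h0 : 0 < r) (h1 : r < 1) (n : ℕ) :
    Real.circleAverage (fun z => conj z ^ n * f z) 0 r = taylorCoeff f n * (r : ℂ) ^ (2 * n) := by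
  have hd : DiffContOnCl ℂ f (ball 0 r) :=
    (hf.mono (by
      rw [closure_ball _ h0.ne']; exact closedBall_subset_ball h1)).diffContOnCl
  have key := DiffContOnCl.circleIntegral_one_div_sub_center_pow_smul h0 n hd
  have h2 : Real.circleAverage (fun z => conj z ^ n * f z) 0 r
      = Real.circleAverage (fun z => ((r : ℂ) ^ (2 * n)) • ((z ^ n)⁻¹ * f z)) 0 r := by
    apply Real.circleAverage_congr_sphere
    intro z hz
    have hz' : ‖z‖ = r := by simpa [abs_of_pos h0] using hz
    have hz0 : z ≠ 0 := by rw [← norm_pos_iff, hz']; exact h0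
    have : conj z * z = (r : ℂ) ^ 2 := by rw [← Complex.normSq_eq_conj_mul_self, Complex.normSq_eq_norm_sq, hz']; simp
    simp only [smul_eq_mul]
    rw [pow_mul, ← this, mul_pow]
    field_simp
  rw [h2, Real.circleAverage_fun_smul, Real.circleAverage_eq_circleIntegral h0.ne']
  have h3 : (∮ z in C(0, r), (z - 0)⁻¹ • ((z ^ n)⁻¹ * f z))
      = ∮ z in C(0, r), (1 / (z - 0) ^ (n + 1)) • f z := by
    congr 1; ext z; simp [pow_succ]; ring
  rw [h3, key, taylorCoeff]
  have := Complex.two_pi_I_ne_zero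
  simp only [smul_eq_mul]
  field_simp


theorem summable_norm_taylorCoeff {f : ℂ → ℂ} (hf : DifferentiableOn ℂ f (ball 0 1)) {r : ℝ}
    (h0 : 0 ≤ r) (h1 : r < 1) : Summable fun n => ‖taylorCoeff f n‖ * r ^ n := by
  have hr : (r : ℂ) ∈ ball (0 : ℂ) 1 := by simp [abs_of_nonneg h0, h1]
  have := (hasSum_taylorCoeff hf hr).summable.norm
  simpa [abs_of_nonneg h0] using this

theorem hasSum_circleAverage {f g : ℂ → ℂ} (hf : DifferentiableOn ℂ f (ball 0 1))
    (hg : DifferentiableOn ℂ g (ball 0 1)) {r : ℝ} (h0 : 0 < r) (h1 : r < 1) :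
    HasSum (fun n => conj (taylorCoeff f n) * taylorCoeff g n * (r : ℂ) ^ (2 * n))
      (Real.circleAverage (fun z => conj (f z) * g z) 0 r) := by
  have hgc := continuous_comp_circleMap hg h0.le h1
  obtain ⟨M, hM⟩ : ∃ M, ∀ θ ∈ Icc (0 : ℝ) (2 * Real.pi), ‖g (circleMap 0 r θ)‖ ≤ M :=
    isCompact_Icc.exists_bound_of_continuousOn hgc.continuousOn
  have hsum := summable_norm_taylorCoeff hf h0.le h1
  have main : HasSum (fun n => ∫ θ in (0 : ℝ)..2 * Real.pi, conj (taylorCoeff f n) *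
      (conj (circleMap 0 r θ) ^ n * g (circleMap 0 r θ)))
      (∫ θ in (0 : ℝ)..2 * Real.pi, conj (f (circleMap 0 r θ)) * g (circleMap 0 r θ)) := by
    refine intervalIntegral.hasSum_integral_of_dominated_convergence
      (fun n _ => ‖taylorCoeff f n‖ * r ^ n * M) ?_ ?_ ?_ ?_ ?_
    · intro n
      refine Continuous.aestronglyMeasurable ?_
      have h := continuous_circleMap 0 r
      exact continuous_const.mul (((Complex.continuous_conj.comp h).pow n).mul hgc)
    · intro n
      refine Eventually.of_forall fun θ hθ => ?_
      rw [uIoc_of_le Real.two_pi_pos.le] at hθ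
      have := hM θ ⟨hθ.1.le, hθ.2⟩
      simp only [norm_mul, norm_pow, RCLike.norm_conj, norm_circleMap_zero, abs_of_pos h0]
      rw [mul_assoc]
      gcongr
    · exact Eventually.of_forall fun θ _ => hsum.mul_right M
    · exact intervalIntegrable_const
    · refine Eventually.of_forall fun θ _ => ?_
      have h2 := hasSum_taylorCoeff hf (mem_ball_circleMap h0.le h1 θ)
      have h3 := (Complex.hasSum_conj'.2 (by simpa using h2) :
        HasSum (fun n => conj (taylorCoeff f n * circleMap 0 r θ ^ n)) (conj (f (circleMap 0 r θ))))
      simpa [mul_assoc] using h3.mul_right (g (circleMap 0 r θ))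
  have h4 := main.const_smul ((2 * Real.pi)⁻¹ : ℝ)
  refine h4.congr_fun ?_ |> fun h => h
  intro n
  rw [mul_assoc, ← circleAverage_conj_pow_mul hg h0 h1 n, intervalIntegral.integral_const_mul,
    Real.circleAverage_def, mul_smul_comm]

theorem ofReal_meanSq (f : ℂ → ℂ) (r : ℝ) :
    ((meanSq f r : ℝ) : ℂ) = Real.circleAverage (fun z => conj (f z) * f z) 0 r := by
  simp only [← Complex.normSq_eq_conj_mul_self, Complex.normSq_eq_norm_sq]
  rw [meanSq, Real.circleAverage_def, Real.circleAverage_def, intervalIntegral.integral_ofReal]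
  simp

theorem hasSum_meanSq {f : ℂ → ℂ} (hf : DifferentiableOn ℂ f (ball 0 1)) {r : ℝ}
    (h0 : 0 < r) (h1 : r < 1) :
    HasSum (fun n => ‖taylorCoeff f n‖ ^ 2 * r ^ (2 * n)) (meanSq f r) := by
  have := hasSum_circleAverage hf hf h0 h1
  rw [← ofReal_meanSq] at this
  rw [← Complex.hasSum_ofReal]
  refine this.congr_fun ?_ |> fun h => h
  intro n
  rw [← Complex.normSq_eq_conj_mul_self, Complex.normSq_eq_norm_sq]
  push_cast; rfl

theorem tendsto_tsum_mul_pow {c : ℕ → ℂ} (hc : Summable fun n => ‖c n‖) :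
    Tendsto (fun r : ℝ => ∑' n, c n * (r : ℂ) ^ (2 * n)) (𝓝[<] 1) (𝓝 (∑' n, c n)) := by
  refine tendsto_tsum_of_dominated_convergence hc ?_ ?_
  · intro n
    have : Continuous fun r : ℝ => c n * (r : ℂ) ^ (2 * n) := by fun_prop
    have := (this.tendsto 1).mono_left (nhdsWithin_le_nhds (s := Iio (1 : ℝ)))
    simpa using this
  · filter_upwards [Ioo_mem_nhdsLT (zero_lt_one (α := ℝ))] with r hr n
    rw [norm_mul, norm_pow, Complex.norm_real, Real.norm_of_nonneg hr.1.le]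
    exact mul_le_of_le_one_right (norm_nonneg _) (pow_le_one₀ hr.1.le hr.2.le)

theorem summable_of_bddAbove {f : ℂ → ℂ} (hf : DifferentiableOn ℂ f (ball 0 1)) {M : ℝ}
    (hM : ∀ r ∈ Ioo (0 : ℝ) 1, meanSq f r ≤ M) : Summable fun n => ‖taylorCoeff f n‖ ^ 2 := by
  refine summable_of_sum_range_le (c := M) (fun n => by positivity) fun N => ?_
  have h1 : Continuous fun r : ℝ => ∑ n ∈ Finset.range N, ‖taylorCoeff f n‖ ^ 2 * r ^ (2 * n) := by
    fun_prop
  have h2 := (h1.tendsto 1).mono_left (nhdsWithin_le_nhds (s := Iio (1 : ℝ)))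
  simp only [one_pow, mul_one] at h2
  refine le_of_tendsto h2 ?_
  filter_upwards [Ioo_mem_nhdsLT (zero_lt_one (α := ℝ))] with r hr
  refine le_trans ?_ (hM r hr)
  exact sum_le_hasSum _ (fun n _ => by have := hr.1; positivity) (hasSum_meanSq hf hr.1 hr.2)

theorem meanSq_le_tsum {f : ℂ → ℂ} (hf : DifferentiableOn ℂ f (ball 0 1))
    (hs : Summable fun n => ‖taylorCoeff f n‖ ^ 2) {r : ℝ} (hr : r ∈ Ioo (0 : ℝ) 1) :
    meanSq f r ≤ ∑' n, ‖taylorCoeff f n‖ ^ 2 := by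
  refine hasSum_le (fun n => ?_) (hasSum_meanSq hf hr.1 hr.2) hs.hasSum
  exact mul_le_of_le_one_right (by positivity) (pow_le_one₀ hr.1.le hr.2.le)

theorem taylorCoeff_add {f g : ℂ → ℂ} (hf : DifferentiableOn ℂ f (ball 0 1))
    (hg : DifferentiableOn ℂ g (ball 0 1)) (n : ℕ) :
    taylorCoeff (f + g) n = taylorCoeff f n + taylorCoeff g n := by
  have h (f : ℂ → ℂ) (hf : DifferentiableOn ℂ f (ball 0 1)) : ContDiffAt ℂ n f 0 :=
    (hf.analyticAt (isOpen_ball.mem_nhds (by simp))).contDiffAt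
  rw [taylorCoeff, iteratedDeriv_add (h f hf) (h g hg), mul_add]; rfl

theorem taylorCoeff_smul {f : ℂ → ℂ} (hf : DifferentiableOn ℂ f (ball 0 1)) (c : ℂ) (n : ℕ) :
    taylorCoeff (c • f) n = c * taylorCoeff f n := by
  have h : ContDiffAt ℂ n f 0 :=
    (hf.analyticAt (isOpen_ball.mem_nhds (by simp))).contDiffAt
  rw [taylorCoeff, iteratedDeriv_const_smul h, taylorCoeff, smul_eq_mul]; ring

/-! ### The Hilbert space structure -/

namespace H2

theorem summable_coeff (f : H2) : Summable fun n => ‖taylorCoeff f n‖ ^ 2 := by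
  obtain ⟨M, hM⟩ := f.bddAbove
  exact summable_of_bddAbove f.differentiableOn fun r hr => hM ⟨r, hr, rfl⟩

/-- The square summable sequence of Taylor coefficients of an element of `H²(D)`. -/
noncomputable def coeffs : H2 →ₗ[ℂ] lp (fun _ : ℕ => ℂ) 2 where
  toFun f := ⟨fun n => taylorCoeff f n, by
    
    refine (memℓp_gen_iff (by norm_num)).2 ?_
    simpa using f.summable_coeff⟩
  map_add' f g := by
    ext n; exact taylorCoeff_add f.differentiableOn g.differentiableOn n
  map_smul' c f := by
    ext n; exact taylorCoeff_smul f.differentiableOn c n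

theorem coeffs_apply (f : H2) (n : ℕ) : coeffs f n = taylorCoeff f n := rfl

theorem coeffs_injective : Function.Injective coeffs := by
  intro f g h
  refine H2.ext fun z hz => ?_
  refine (hasSum_taylorCoeff f.differentiableOn hz).unique ?_
  have h2 (n : ℕ) : taylorCoeff f n = taylorCoeff g n := by
    rw [← coeffs_apply, h, coeffs_apply]
  simp only [h2]
  exact hasSum_taylorCoeff g.differentiableOn hz

/-- The inner product of `H²(D)`, conjugate linear in the first variable:
`lim_{r → 1⁻} (1/2π) ∫₀^{2π} conj (f(r e^{iθ})) g(r e^{iθ}) dθ`. -/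
noncomputable def innerProd (f g : H2) : ℂ :=
  limUnder (𝓝[<] (1 : ℝ)) fun r => Real.circleAverage (fun z => conj (f z) * g z) 0 r

/-- The limit that defines the inner product exists. -/
theorem tendsto_inner_coeffs (f g : H2) :
    Tendsto (fun r : ℝ => Real.circleAverage (fun z => conj (f z) * g z) 0 r) (𝓝[<] 1)
      (𝓝 (inner ℂ (coeffs f) (coeffs g))) := by
  have hs := lp.summable_inner (𝕜 := ℂ) (coeffs f) (coeffs g)
  rw [lp.inner_eq_tsum]
  have e (n : ℕ) : inner ℂ (coeffs f n) (coeffs g n)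
      = conj (taylorCoeff f n) * taylorCoeff g n := by
    simp [coeffs_apply, mul_comm]
  simp only [e] at hs ⊢
  refine (tendsto_tsum_mul_pow hs.norm).congr' ?_
  filter_upwards [Ioo_mem_nhdsLT (zero_lt_one (α := ℝ))] with r hr
  exact (hasSum_circleAverage f.differentiableOn g.differentiableOn hr.1 hr.2).tsum_eq

theorem innerProd_eq_coeffs (f g : H2) : innerProd f g = inner ℂ (coeffs f) (coeffs g) :=
  (tendsto_inner_coeffs f g).limUnder_eq

@[reducible]
noncomputable def innerCore : InnerProductSpace.Core ℂ H2 where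
  inner := innerProd
  conj_inner_symm f g := by simp only [innerProd_eq_coeffs]; exact inner_conj_symm _ _
  re_inner_nonneg f := by rw [innerProd_eq_coeffs]; exact inner_self_nonneg
  add_left f g h := by simp only [innerProd_eq_coeffs, map_add, inner_add_left]
  smul_left f g c := by simp only [innerProd_eq_coeffs, map_smul, inner_smul_left]
  definite f h := by
    rw [innerProd_eq_coeffs, inner_self_eq_zero] at h
    exact coeffs_injective (h.trans (map_zero _).symm)

noncomputable instance : NormedAddCommGroup H2 := innerCore.toNormedAddCommGroup

noncomputable instance : InnerProductSpace ℂ H2 := InnerProductSpace.ofCore innerCore.toCore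

theorem inner_def (f g : H2) : inner ℂ f g =
    limUnder (𝓝[<] (1 : ℝ)) fun r => Real.circleAverage (fun z => conj (f z) * g z) 0 r := rfl

theorem inner_eq_coeffs (f g : H2) : inner ℂ f g = inner ℂ (coeffs f) (coeffs g) :=
  innerProd_eq_coeffs f g

theorem tendsto_inner (f g : H2) :
    Tendsto (fun r : ℝ => Real.circleAverage (fun z => conj (f z) * g z) 0 r) (𝓝[<] 1)
      (𝓝 (inner ℂ f g)) := by
  rw [inner_eq_coeffs]; exact tendsto_inner_coeffs f g

theorem norm_coeffs (f : H2) : ‖coeffs f‖ = ‖f‖ := by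
  rw [@norm_eq_sqrt_re_inner ℂ _ _ _ _ f, @norm_eq_sqrt_re_inner ℂ _ _ _ _ (coeffs f),
    inner_eq_coeffs]

theorem norm_sq_eq_tsum (f : H2) : ‖f‖ ^ 2 = ∑' n, ‖taylorCoeff f n‖ ^ 2 := by
  rw [← norm_coeffs]
  simpa [coeffs_apply] using lp.norm_rpow_eq_tsum (p := 2) (by norm_num) (coeffs f)

theorem meanSq_le (f : H2) {r : ℝ} (hr : r ∈ Ioo (0 : ℝ) 1) : meanSq f r ≤ ‖f‖ ^ 2 := by
  rw [norm_sq_eq_tsum]; exact meanSq_le_tsum f.differentiableOn f.summable_coeff hr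

/-- The norm is `‖f‖² = sup_{0<r<1} (1/2π) ∫₀^{2π} |f(r e^{iθ})|² dθ`. -/
theorem isLUB_norm_sq (f : H2) : IsLUB (meanSq f '' Ioo 0 1) (‖f‖ ^ 2) := by
  refine ⟨?_, fun M hM => ?_⟩
  · rintro _ ⟨r, hr, rfl⟩; exact meanSq_le f hr
  · have h := tendsto_inner f f
    simp only [← ofReal_meanSq] at h
    have h2 := (Complex.continuous_re.tendsto _).comp h
    have h3 : Tendsto (meanSq f) (𝓝[<] 1) (𝓝 (‖f‖ ^ 2)) := by
      convert! h2 using 2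
      exact (inner_self_eq_norm_sq (𝕜 := ℂ) f).symm
    refine le_of_tendsto h3 ?_
    filter_upwards [Ioo_mem_nhdsLT (zero_lt_one (α := ℝ))] with r hr
    exact hM ⟨r, hr, rfl⟩

theorem exists_coeffs_eq (a : lp (fun _ : ℕ => ℂ) 2) : ∃ f : H2, coeffs f = a := by
  set p : FormalMultilinearSeries ℂ ℂ ℂ := FormalMultilinearSeries.ofScalars ℂ (a : ℕ → ℂ) with hp
  have hrad : (1 : ENNReal) ≤ p.radius := by
    refine p.le_radius_of_bound (r := 1) ‖a‖ fun n => ?_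
    rw [hp, FormalMultilinearSeries.ofScalars_norm]
    simpa using lp.norm_apply_le_norm (by norm_num) a n
  have hball := p.hasFPowerSeriesOnBall (zero_lt_one.trans_le hrad)
  have hd : DifferentiableOn ℂ p.sum (ball 0 1) := by
    refine hball.differentiableOn.mono ?_
    intro z hz
    rw [← Metric.eball_ofReal] at hz
    exact Metric.eball_subset_eball (by simpa using hrad) hz
  set F : ℂ → ℂ := (ball (0 : ℂ) 1).indicator p.sum with hF
  have hFd : DifferentiableOn ℂ F (ball 0 1) := hd.congr fun z hz => indicator_of_mem hz _
  have h0 : (0 : ℂ) ∈ ball (0 : ℂ) 1 := by simp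
  have hev : F =ᶠ[𝓝 0] p.sum := by
    filter_upwards [isOpen_ball.mem_nhds h0] with z hz
    exact indicator_of_mem hz _
  have hcoef (n : ℕ) : taylorCoeff F n = a n := by
    have h1 := hball.hasFPowerSeriesAt
    have h2 := (hball.analyticAt).hasFPowerSeriesAt
    have h3 := h2.eq_formalMultilinearSeries h1
    have h4 := FormalMultilinearSeries.ofScalars_series_injective ℂ ℂ h3
    have h5 := congrFun h4 n
    rw [taylorCoeff, hev.iteratedDeriv_eq, ← h5, div_eq_inv_mul]
  have hs : Summable fun n => ‖taylorCoeff F n‖ ^ 2 := by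
    simp only [hcoef]
    simpa using (memℓp_gen_iff (p := 2) (by norm_num)).1 a.2
  refine ⟨⟨F, hFd, fun z hz => indicator_of_notMem hz _, ∑' n, ‖taylorCoeff F n‖ ^ 2, ?_⟩, ?_⟩
  · rintro _ ⟨r, hr, rfl⟩
    exact meanSq_le_tsum hFd hs hr
  · ext n
    exact hcoef n

instance : CompleteSpace H2 := by
  let e : H2 →ₗᵢ[ℂ] lp (fun _ : ℕ => ℂ) 2 := ⟨coeffs, norm_coeffs⟩
  rw [completeSpace_iff_isComplete_range e.isometry.isUniformInducing,
    (show Function.Surjective e from exists_coeffs_eq).range_eq]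
  exact completeSpace_iff_isComplete_univ.1 inferInstance

end H2

/-! ### Composition operators -/

/-- Analytic maps of the unit disc into itself. (The values outside the disc are irrelevant.) -/
structure AnalyticSelfMap where
  /-- the underlying function -/
  toFun : ℂ → ℂ
  differentiableOn : DifferentiableOn ℂ toFun (ball 0 1)
  mapsTo : MapsTo toFun (ball 0 1) (ball 0 1)

instance : CoeFun AnalyticSelfMap fun _ => ℂ → ℂ := ⟨AnalyticSelfMap.toFun⟩

theorem continuous_herglotz {X : Type*} [TopologicalSpace X] {u v : X → ℂ} (hu : Continuous u)
    (hv : Continuous v) (h : ∀ x, v x ≠ u x) :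
    Continuous fun x => (herglotzRieszKernel 0 (u x) (v x)).re := by
  simp only [herglotzRieszKernel_def, sub_zero]
  exact Complex.continuous_re.comp ((hv.add hu).div (hv.sub hu) fun x => sub_ne_zero.2 (h x))

theorem re_herglotz_nonneg {R : ℝ} {w ζ : ℂ} (hw : ‖w‖ < R) (hζ : ‖ζ‖ = R) :
    0 ≤ (herglotzRieszKernel 0 w ζ).re := by
  have h := le_re_herglotzRieszKernel (c := 0) (R := R) (w := w) (z := ζ) (by simpa using hζ)
    (by simpa using hw)
  refine le_trans ?_ h
  have := norm_nonneg w
  simp only [sub_zero]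
  exact div_nonneg (by linarith) (by linarith)

theorem normSq_le_circleAverage {f : ℂ → ℂ} (hf : DifferentiableOn ℂ f (ball 0 1)) {R : ℝ}
    (h0 : 0 < R) (h1 : R < 1) {w : ℂ} (hw : ‖w‖ < R) :
    ‖f w‖ ^ 2 ≤
      Real.circleAverage (fun ζ => (herglotzRieszKernel 0 w ζ).re * ‖f ζ‖ ^ 2) 0 R := by
  have hd : DiffContOnCl ℂ (fun z => f z ^ 2) (ball 0 R) :=
    ((hf.pow 2).mono (by
      rw [closure_ball _ h0.ne']; exact closedBall_subset_ball h1)).diffContOnCl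
  have hP := hd.circleAverage_re_herglotzRieszKernel_smul (w := w) (by simpa using hw)
  rw [← norm_pow, ← hP, Real.circleAverage_def, Real.circleAverage_def, norm_smul, smul_eq_mul,
    Real.norm_of_nonneg (by positivity)]
  gcongr
  refine (intervalIntegral.norm_integral_le_integral_norm Real.two_pi_pos.le).trans_eq ?_
  refine intervalIntegral.integral_congr fun θ _ => ?_
  simp only [Pi.smul_apply', Function.comp_apply, norm_smul, norm_pow]
  rw [Real.norm_of_nonneg (re_herglotz_nonneg hw (by simp [abs_of_pos h0]))]

theorem exists_radius (φ : AnalyticSelfMap) {r : ℝ} (h1 : r < 1) :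
    ∃ R : ℝ, (1 + ‖φ 0‖) / 2 ≤ R ∧ R < 1 ∧ ∀ z ∈ closedBall (0 : ℂ) r, ‖φ z‖ < R := by
  have h0 : ‖φ 0‖ < 1 := by simpa using φ.mapsTo (x := 0) (by simp)
  have hsub : closedBall (0 : ℂ) r ⊆ ball 0 1 := closedBall_subset_ball h1
  obtain hne | hne := (closedBall (0 : ℂ) r).eq_empty_or_nonempty
  · exact ⟨(1 + ‖φ 0‖) / 2, le_rfl, by linarith, by simp [hne]⟩
  · obtain ⟨z₀, hz₀, hmax⟩ := (isCompact_closedBall (0 : ℂ) r).exists_isMaxOn hne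
      (φ.differentiableOn.continuousOn.mono hsub).norm
    have h2 : ‖φ z₀‖ < 1 := by simpa using φ.mapsTo (hsub hz₀)
    refine ⟨max ((1 + ‖φ 0‖) / 2) ((1 + ‖φ z₀‖) / 2), le_max_left _ _,
      max_lt (by linarith) (by linarith), fun z hz => ?_⟩
    have h3 : ‖φ z‖ ≤ ‖φ z₀‖ := hmax hz
    exact lt_of_lt_of_le (by linarith) (le_max_right _ _)

theorem circleAverage_herglotz_comp (φ : AnalyticSelfMap) {r R : ℝ} (h0 : 0 < r) (h1 : r < 1)
    (hR : ∀ z ∈ closedBall (0 : ℂ) r, ‖φ z‖ < R) {ζ : ℂ} (hζ : ‖ζ‖ = R) :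
    Real.circleAverage (fun z => (herglotzRieszKernel 0 (φ z) ζ).re) 0 r
      = (herglotzRieszKernel 0 (φ 0) ζ).re := by
  have hne (z : ℂ) (hz : z ∈ closedBall (0 : ℂ) r) : ζ - φ z ≠ 0 := by
    intro h
    have h2 := hR z hz
    rw [← sub_eq_zero.1 h, hζ] at h2
    exact lt_irrefl _ h2
  have hφ : DifferentiableOn ℂ φ (closedBall 0 r) :=
    φ.differentiableOn.mono (closedBall_subset_ball h1)
  have hd : DifferentiableOn ℂ (fun z => herglotzRieszKernel 0 (φ z) ζ) (closedBall 0 r) := by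
    simp only [herglotzRieszKernel_def, sub_zero]
    exact ((differentiableOn_const ζ).add hφ).div ((differentiableOn_const ζ).sub hφ) hne
  have hm := DiffContOnCl.circleAverage (R := r) (c := 0)
    (f := fun z => herglotzRieszKernel 0 (φ z) ζ) (by
      rw [abs_of_pos h0]
      exact DifferentiableOn.diffContOnCl (by rwa [closure_ball _ h0.ne']))
  rw [← hm]
  refine Complex.reCLM.circleAverage_comp_comm (f := fun z => herglotzRieszKernel 0 (φ z) ζ) ?_
  refine ContinuousOn.circleIntegrable h0.le (hd.continuousOn.mono sphere_subset_closedBall)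

/-- Composition with an analytic self-map of the disc is bounded in the mean. -/
theorem meanSq_comp_le (φ : AnalyticSelfMap) (f : H2) {r : ℝ} (hr : r ∈ Ioo (0 : ℝ) 1) :
    meanSq (fun z => f (φ z)) r ≤ 4 / (1 - ‖φ 0‖) * ‖f‖ ^ 2 := by
  obtain ⟨h0, h1⟩ := hr
  obtain ⟨R, hR0, hR1, hR⟩ := exists_radius φ h1
  have hφ0 : ‖φ 0‖ < 1 := by simpa using φ.mapsTo (x := 0) (by simp)
  have hn := norm_nonneg (φ 0)
  have hRpos : 0 < R := by linarith
  have hmem (α : ℝ) : circleMap 0 r α ∈ closedBall (0 : ℂ) r :=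
    sphere_subset_closedBall (circleMap_mem_sphere 0 h0.le α)
  have hfd := f.differentiableOn
  have hfφ : DifferentiableOn ℂ (fun z => f (φ z)) (ball 0 1) :=
    hfd.comp φ.differentiableOn φ.mapsTo
  have hcφ := continuous_comp_circleMap φ.differentiableOn h0.le h1
  have hcf := continuous_comp_circleMap hfd hRpos.le hR1
  obtain ⟨F, hFdef⟩ : ∃ F : ℝ → ℝ → ℝ, ∀ α β, F α β =
    (herglotzRieszKernel 0 (φ (circleMap 0 r α)) (circleMap 0 R β)).re *
      ‖f (circleMap 0 R β)‖ ^ 2 := ⟨_, fun _ _ => rfl⟩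
  have hF : Continuous F.uncurry := by
    simp only [Function.uncurry_def, hFdef]
    refine Continuous.mul ?_ ((hcf.comp continuous_snd).norm.pow 2)
    refine continuous_herglotz (hcφ.comp continuous_fst)
      ((continuous_circleMap 0 R).comp continuous_snd) fun x hx => ?_
    have h2 := hR _ (hmem x.1)
    have h3 : ‖circleMap 0 R x.2‖ = R := by simp [abs_of_pos hRpos]
    have h4 : circleMap 0 R x.2 = φ (circleMap 0 r x.1) := hx
    rw [← h4, h3] at h2
    exact lt_irrefl _ h2
  have hpi : (0 : ℝ) ≤ (2 * Real.pi)⁻¹ := by positivity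
  have hpi2 := Real.two_pi_pos.le
  calc meanSq (fun z => f (φ z)) r
      = (2 * Real.pi)⁻¹ * ∫ α in (0 : ℝ)..2 * Real.pi, ‖f (φ (circleMap 0 r α))‖ ^ 2 := rfl
    _ ≤ (2 * Real.pi)⁻¹ * ∫ α in (0 : ℝ)..2 * Real.pi,
          (2 * Real.pi)⁻¹ * ∫ β in (0 : ℝ)..2 * Real.pi, F α β := by
        refine mul_le_mul_of_nonneg_left ?_ hpi
        refine intervalIntegral.integral_mono_on hpi2 ?_ ?_ ?_
        · exact ((continuous_comp_circleMap hfφ h0.le h1).norm.pow 2).intervalIntegrable _ _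
        · refine Continuous.intervalIntegrable ?_ _ _
          exact continuous_const.mul
            (intervalIntegral.continuous_parametric_intervalIntegral_of_continuous' hF _ _)
        · intro α _
          simp only [hFdef]
          exact normSq_le_circleAverage hfd hRpos hR1 (hR _ (hmem α))
    _ = (2 * Real.pi)⁻¹ * ∫ β in (0 : ℝ)..2 * Real.pi,
          (2 * Real.pi)⁻¹ * ∫ α in (0 : ℝ)..2 * Real.pi, F α β := by
        rw [intervalIntegral.integral_const_mul, intervalIntegral.integral_const_mul,
          MeasureTheory.intervalIntegral_intervalIntegral_swap]
        exact (hF.continuousOn.integrableOn_compact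
          (isCompact_uIcc.prod isCompact_uIcc)).mono_set
          (Set.prod_mono uIoc_subset_uIcc uIoc_subset_uIcc)
    _ ≤ (2 * Real.pi)⁻¹ * ∫ β in (0 : ℝ)..2 * Real.pi,
          4 / (1 - ‖φ 0‖) * ‖f (circleMap 0 R β)‖ ^ 2 := by
        refine mul_le_mul_of_nonneg_left ?_ hpi
        refine intervalIntegral.integral_mono_on hpi2 ?_ ?_ ?_
        · refine Continuous.intervalIntegrable ?_ _ _
          have hF' : Continuous (Function.uncurry fun β α => F α β) := hF.comp continuous_swap
          exact continuous_const.mul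
            (intervalIntegral.continuous_parametric_intervalIntegral_of_continuous' hF' _ _)
        · exact (continuous_const.mul (hcf.norm.pow 2)).intervalIntegrable _ _
        · intro β _
          have hζ : ‖circleMap 0 R β‖ = R := by simp [abs_of_pos hRpos]
          have h2 := circleAverage_herglotz_comp φ h0 h1 hR hζ
          rw [Real.circleAverage_def, smul_eq_mul] at h2
          simp only [hFdef]
          rw [intervalIntegral.integral_mul_const, ← mul_assoc, h2]
          refine mul_le_mul_of_nonneg_right ?_ (by positivity)
          have h3 := re_herglotzRieszKernel_le (c := 0) (R := R) (w := φ 0)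
            (z := circleMap 0 R β) (by simpa using hζ)
            (by simpa using (show ‖φ 0‖ < R by linarith))
          refine h3.trans ?_
          simp only [sub_zero]
          rw [div_le_div_iff₀ (by linarith) (by linarith)]
          nlinarith
    _ = 4 / (1 - ‖φ 0‖) * meanSq f R := by
        rw [intervalIntegral.integral_const_mul, meanSq, Real.circleAverage_def, smul_eq_mul]
        ring
    _ ≤ 4 / (1 - ‖φ 0‖) * ‖f‖ ^ 2 := by
        refine mul_le_mul_of_nonneg_left (f.meanSq_le ⟨hRpos, hR1⟩) ?_
        exact div_nonneg (by norm_num) (by linarith)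

theorem meanSq_indicator (u : ℂ → ℂ) {r : ℝ} (hr : r ∈ Ioo (0 : ℝ) 1) :
    meanSq ((ball (0 : ℂ) 1).indicator u) r = meanSq u r := by
  refine Real.circleAverage_congr_sphere fun z hz => ?_
  have : z ∈ ball (0 : ℂ) 1 := by
    have h : ‖z‖ = r := by simpa [abs_of_pos hr.1] using hz
    simpa [h] using hr.2
  simp only [indicator_of_mem this]

/-- The function `f ∘ φ` on the disc, as an element of `H²(D)`. -/
noncomputable def compFun (φ : AnalyticSelfMap) (f : H2) : H2 :=
  ⟨(ball (0 : ℂ) 1).indicator fun z => f (φ z),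
    (f.differentiableOn.comp φ.differentiableOn φ.mapsTo).congr fun _ hz => indicator_of_mem hz _,
    fun _ hz => indicator_of_notMem hz _, 4 / (1 - ‖φ 0‖) * ‖f‖ ^ 2, by
      rintro _ ⟨r, hr, rfl⟩
      rw [meanSq_indicator _ hr]
      exact meanSq_comp_le φ f hr⟩

theorem compFun_apply (φ : AnalyticSelfMap) (f : H2) {z : ℂ} (hz : z ∈ ball (0 : ℂ) 1) :
    compFun φ f z = f (φ z) :=
  indicator_of_mem hz fun z => f (φ z)

theorem norm_compFun_le (φ : AnalyticSelfMap) (f : H2) :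
    ‖compFun φ f‖ ≤ √(4 / (1 - ‖φ 0‖)) * ‖f‖ := by
  have hφ0 : ‖φ 0‖ < 1 := by simpa using φ.mapsTo (x := 0) (by simp)
  have h : (0 : ℝ) ≤ 4 / (1 - ‖φ 0‖) := div_nonneg (by norm_num) (by linarith)
  refine le_of_sq_le_sq ?_ (by positivity)
  rw [mul_pow, Real.sq_sqrt h]
  refine (H2.isLUB_norm_sq (compFun φ f)).2 ?_
  rintro _ ⟨r, hr, rfl⟩
  exact (meanSq_indicator _ hr).trans_le (meanSq_comp_le φ f hr)

/-- The composition operator `C_φ f = f ∘ φ`, a bounded operator on `H²(D)`. -/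
noncomputable def compOp (φ : AnalyticSelfMap) : H2 →L[ℂ] H2 :=
  LinearMap.mkContinuous
    { toFun := compFun φ
      map_add' := fun f g => H2.ext fun z hz => by
        rw [H2.add_apply, compFun_apply φ _ hz, compFun_apply φ _ hz, compFun_apply φ _ hz,
          H2.add_apply]
      map_smul' := fun c f => H2.ext fun z hz => by
        rw [RingHom.id_apply, H2.smul_apply, compFun_apply φ _ hz, compFun_apply φ _ hz,
          H2.smul_apply] }
    (√(4 / (1 - ‖φ 0‖))) (norm_compFun_le φ)

theorem compOp_apply (φ : AnalyticSelfMap) (f : H2) {z : ℂ} (hz : z ∈ ball (0 : ℂ) 1) :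
    compOp φ f z = f (φ z) := compFun_apply φ f hz

/-- The map of the disc is a linear fractional transformation: on the disc it is the action of an
invertible matrix on the Riemann sphere `ℂ ∪ {∞}`,
`z ↦ (A₀₀ z + A₀₁) / (A₁₀ z + A₁₁)`. -/
def AnalyticSelfMap.IsGivenBy (φ : AnalyticSelfMap) (A : Matrix.GeneralLinearGroup (Fin 2) ℂ) :
    Prop :=
  ∀ z ∈ ball (0 : ℂ) 1, A • (z : OnePoint ℂ) = ((φ z : ℂ) : OnePoint ℂ)

/-- A self-map of the disc is an automorphism if it is an analytic bijection. -/
def AnalyticSelfMap.IsAutomorphism (φ : AnalyticSelfMap) : Prop :=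
  BijOn φ (ball 0 1) (ball 0 1)

end HardyDisc

/-! ### Complex symmetric operators -/

/-- A conjugation on a complex Hilbert space: a conjugate linear isometric involution. -/
structure IsConjugation {H : Type*} [NormedAddCommGroup H] [InnerProductSpace ℂ H] (C : H → H) :
    Prop where
  conj_linear : ∀ (a b : ℂ) (x y : H),
    C (a • x + b • y) = (starRingEnd ℂ) a • C x + (starRingEnd ℂ) b • C y
  isometric : ∀ x y : H, inner ℂ (C x) (C y) = inner ℂ y x
  involutive : ∀ x : H, C (C x) = x

/-- A bounded operator `T` is complex symmetric if `T = C T* C` for some conjugation `C`. -/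
def IsComplexSymmetric {H : Type*} [NormedAddCommGroup H] [InnerProductSpace ℂ H] [CompleteSpace H]
    (T : H →L[ℂ] H) : Prop :=
  ∃ C : H → H, IsConjugation C ∧ ∀ x : H, T x = C (ContinuousLinearMap.adjoint T (C x))

/-! Put `l = φ'(a)`. Schwarz–Pick gives `|l| < 1` for a non-automorphism, and `l ≠ 0` because the
matrix is invertible. Hence `φ` has a second fixed point `a - 1/h` on the sphere, and in the
coordinate `w` with `z = a + w / (1 - h w)` it becomes `w ↦ l w` (`exists_isLinearizedBy`). The
second fixed point is `∞` exactly when `h = 0`, so the task is to exclude `h ≠ 0`.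

The functional sending `f` to its `n`-th Taylor coefficient in the coordinate `w` is represented by
a vector `v n`, an eigenvector of the adjoint for `conj l ^ n` (`exists_inner_eq_taylorCoeff`,
`taylorCoeff_compOp`). A symmetrizing conjugation `C` carries `v n` to an eigenfunction of the
composition operator for `l ^ n`, and these are unique up to a scalar: `C (v n) = d n * ((z - a) /
(1 + h (z - a))) ^ n` (`eigenfunction`).

Since `⟨C x, C y⟩ = ⟨y, x⟩`, the Gram matrices of the two families determine each other. One
consists of Taylor coefficients of explicit rational functions. In the other, the rows 0 and 1 are
point evaluations, because `C (v 0)` and, for `h ≠ 0`, `C (v 1)` are combinations of reproducing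
kernels. The unknown scalars enter only through the rank-one array `conj (d m) * d n` and can be
eliminated from the entries (0,0), (0,1), (0,2), (1,1), (1,2). What survives is `a² * conj a * h =
0`, a contradiction (`gram_relations_inconsistent`). -/

theorem IsConjugation.map_smul {H : Type*} [NormedAddCommGroup H] [InnerProductSpace ℂ H]
    {C : H → H} (hC : IsConjugation C) (c : ℂ) (x : H) : C (c • x) = (starRingEnd ℂ) c • C x := by
  simpa using hC.conj_linear c 0 x 0

/-- A conjugation that symmetrizes `T` maps eigenvectors of `T*` to eigenvectors of `T`. -/
theorem IsConjugation.apply_eigenvector {H : Type*} [NormedAddCommGroup H] [InnerProductSpace ℂ H]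
    [CompleteSpace H] {C : H → H} (hC : IsConjugation C) {T : H →L[ℂ] H}
    (hT : ∀ x : H, T x = C (ContinuousLinearMap.adjoint T (C x))) {v : H} {μ : ℂ}
    (hv : ∀ f : H, inner ℂ v (T f) = μ * inner ℂ v f) : T (C v) = μ • C v := by
  have h : ContinuousLinearMap.adjoint T v = (starRingEnd ℂ) μ • v := by
    refine ext_inner_right ℂ fun f => ?_
    rw [ContinuousLinearMap.adjoint_inner_left, hv, inner_smul_left, Complex.conj_conj]
  rw [hT, hC.involutive, h, hC.map_smul, Complex.conj_conj]

namespace HardyDisc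

open Complex Metric Set Filter Topology
open scoped ComplexConjugate

/-! ### Taylor coefficients of germs -/

theorem eventually_hasSum_taylorCoeff {F : ℂ → ℂ} (hF : AnalyticAt ℂ F 0) :
    ∀ᶠ w in 𝓝 (0 : ℂ), HasSum (fun n => w ^ n * taylorCoeff F n) (F w) := by
  have h := hasFPowerSeriesAt_iff.1 hF.hasFPowerSeriesAt
  filter_upwards [h] with w hw
  simpa [FormalMultilinearSeries.coeff_ofScalars, taylorCoeff, div_eq_inv_mul] using hw

theorem taylorCoeff_eq_of_eventually_hasSum {F : ℂ → ℂ} {c : ℕ → ℂ}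
    (h : ∀ᶠ w in 𝓝 (0 : ℂ), HasSum (fun n => w ^ n * c n) (F w)) (n : ℕ) :
    taylorCoeff F n = c n := by
  have h1 : HasFPowerSeriesAt F (FormalMultilinearSeries.ofScalars ℂ c) 0 := by
    rw [hasFPowerSeriesAt_iff]
    simpa [FormalMultilinearSeries.coeff_ofScalars] using h
  have h2 := h1.analyticAt.hasFPowerSeriesAt.eq_formalMultilinearSeries h1
  have h3 := congrFun (FormalMultilinearSeries.ofScalars_series_injective ℂ ℂ h2) n
  rw [taylorCoeff, ← h3, div_eq_inv_mul]

theorem taylorCoeff_congr {F G : ℂ → ℂ} (h : F =ᶠ[𝓝 0] G) (n : ℕ) :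
    taylorCoeff F n = taylorCoeff G n := by
  rw [taylorCoeff, taylorCoeff, h.iteratedDeriv_eq]

theorem taylorCoeff_zero (F : ℂ → ℂ) : taylorCoeff F 0 = F 0 := by simp [taylorCoeff]

theorem taylorCoeff_comp_const_mul {F : ℂ → ℂ} (hF : AnalyticAt ℂ F 0) (l : ℂ) (n : ℕ) :
    taylorCoeff (fun w => F (l * w)) n = l ^ n * taylorCoeff F n := by
  refine taylorCoeff_eq_of_eventually_hasSum (c := fun n => l ^ n * taylorCoeff F n) ?_ n
  have ht : Tendsto (fun w : ℂ => l * w) (𝓝 0) (𝓝 0) := by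
    simpa using (continuous_const_mul l).tendsto 0
  filter_upwards [ht.eventually (eventually_hasSum_taylorCoeff hF)] with w hw
  simpa [mul_pow, mul_assoc, mul_left_comm] using hw

theorem taylorCoeff_add_of_analyticAt {F G : ℂ → ℂ} (hF : AnalyticAt ℂ F 0)
    (hG : AnalyticAt ℂ G 0) (n : ℕ) :
    taylorCoeff (fun w => F w + G w) n = taylorCoeff F n + taylorCoeff G n := by
  refine taylorCoeff_eq_of_eventually_hasSum (c := fun n => taylorCoeff F n + taylorCoeff G n) ?_ n
  filter_upwards [eventually_hasSum_taylorCoeff hF, eventually_hasSum_taylorCoeff hG] with w h1 h2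
  simpa [mul_add] using h1.add h2

theorem taylorCoeff_const_mul {F : ℂ → ℂ} (hF : AnalyticAt ℂ F 0) (c : ℂ) (n : ℕ) :
    taylorCoeff (fun w => c * F w) n = c * taylorCoeff F n := by
  refine taylorCoeff_eq_of_eventually_hasSum (c := fun n => c * taylorCoeff F n) ?_ n
  filter_upwards [eventually_hasSum_taylorCoeff hF] with w h1
  simpa [mul_left_comm] using h1.mul_left c

theorem taylorCoeff_succ_of_eventuallyEq {F G : ℂ → ℂ} {c : ℂ} (hG : AnalyticAt ℂ G 0)
    (h : ∀ᶠ w in 𝓝 (0 : ℂ), F w = c + w * G w) (n : ℕ) :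
    taylorCoeff F (n + 1) = taylorCoeff G n := by
  refine taylorCoeff_eq_of_eventually_hasSum (F := F)
    -- The coefficient sequence of `G` with `c` put in front.
    (c := fun n => Nat.casesOn n c (taylorCoeff G)) ?_ (n + 1)
  filter_upwards [h, eventually_hasSum_taylorCoeff hG] with w h1 h2
  rw [h1, ← hasSum_nat_add_iff' 1]
  simpa [pow_succ', mul_assoc] using h2.mul_left w

/-- A germ on which scaling the variable by `l` acts as multiplication by `l ^ n` is a monomial. -/
theorem eventually_eq_monomial {F : ℂ → ℂ} (hF : AnalyticAt ℂ F 0) {l : ℂ} (h0 : l ≠ 0)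
    (h1 : ‖l‖ < 1) {n : ℕ} (h : ∀ᶠ w in 𝓝 (0 : ℂ), F (l * w) = l ^ n * F w) :
    ∀ᶠ w in 𝓝 (0 : ℂ), F w = taylorCoeff F n * w ^ n := by
  have hk (k : ℕ) (hkn : k ≠ n) : taylorCoeff F k = 0 := by
    have h2 := taylorCoeff_congr h k
    rw [taylorCoeff_comp_const_mul hF, taylorCoeff_const_mul hF] at h2
    by_contra h3
    -- Powers of `‖l‖` with different exponents differ because `0 < ‖l‖ < 1`.
    have h4 := congrArg norm (mul_right_cancel₀ h3 h2)
    rw [norm_pow, norm_pow] at h4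
    exact hkn (pow_right_injective₀ (norm_pos_iff.2 h0) h1.ne h4)
  filter_upwards [eventually_hasSum_taylorCoeff hF] with w hw
  refine hw.unique ?_
  rw [mul_comm]
  exact hasSum_single n fun k hkn => by rw [hk k hkn, mul_zero]

/-! ### The Schwarz–Pick lemma at a fixed point -/

theorem one_sub_conj_mul_ne_zero {a z : ℂ} (ha : ‖a‖ < 1) (hz : ‖z‖ < 1) : 1 - conj a * z ≠ 0 := by
  intro h
  have h2 : ‖conj a * z‖ = 1 := by rw [← sub_eq_zero.1 h, norm_one]
  rw [norm_mul, RCLike.norm_conj] at h2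
  nlinarith [norm_nonneg a, norm_nonneg z]

/-- The involutive automorphism of the disc that exchanges `0` and `a`. -/
noncomputable def discInvolution (a z : ℂ) : ℂ := (a - z) / (1 - conj a * z)

theorem discInvolution_zero (a : ℂ) : discInvolution a 0 = a := by simp [discInvolution]

theorem discInvolution_self (a : ℂ) : discInvolution a a = 0 := by simp [discInvolution]

/-- Everything rests on the identity `|1 - āz|² - |a - z|² = (1 - |a|²)(1 - |z|²)`. -/
theorem norm_discInvolution_lt {a z : ℂ} (ha : ‖a‖ < 1) (hz : ‖z‖ < 1) :
    ‖discInvolution a z‖ < 1 := by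
  have h := one_sub_conj_mul_ne_zero ha hz
  rw [discInvolution, norm_div, div_lt_one (norm_pos_iff.2 h)]
  refine lt_of_pow_lt_pow_left₀ 2 (norm_nonneg _) ?_
  have e : (‖1 - conj a * z‖ ^ 2 : ℝ) - ‖a - z‖ ^ 2 = (1 - ‖a‖ ^ 2) * (1 - ‖z‖ ^ 2) := by
    rw [← Complex.ofReal_inj]
    push_cast
    simp only [← Complex.mul_conj', map_sub, map_mul, map_one, Complex.conj_conj]
    ring
  have h1 : 0 < 1 - ‖a‖ ^ 2 := by nlinarith [norm_nonneg a]
  have h2 : 0 < 1 - ‖z‖ ^ 2 := by nlinarith [norm_nonneg z]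
  nlinarith [mul_pos h1 h2]

theorem discInvolution_discInvolution {a z : ℂ} (ha : ‖a‖ < 1) (hz : ‖z‖ < 1) :
    discInvolution a (discInvolution a z) = z := by
  have h := one_sub_conj_mul_ne_zero ha hz
  have h2 := one_sub_conj_mul_ne_zero ha ha
  have h3 := one_sub_conj_mul_ne_zero ha (norm_discInvolution_lt ha hz)
  rw [discInvolution, div_eq_iff h3]
  rw [discInvolution] at h3 ⊢
  generalize conj a = b at *
  have h4 : 1 - b * ((a - z) / (1 - b * z)) = (1 - b * a) / (1 - b * z) := by
    rw [eq_div_iff h]; field_simp; ring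
  rw [h4, mul_div_assoc', eq_div_iff h, sub_mul, div_mul_cancel₀ _ h]
  ring

theorem hasDerivAt_discInvolution {a z : ℂ} (ha : ‖a‖ < 1) (hz : ‖z‖ < 1) :
    HasDerivAt (discInvolution a) (-(1 - conj a * a) / (1 - conj a * z) ^ 2) z := by
  have h := one_sub_conj_mul_ne_zero ha hz
  have h1 := ((hasDerivAt_id z).const_sub a).div
    (((hasDerivAt_id z).const_mul (conj a)).const_sub 1) h
  convert! h1 using 1
  simp
  ring

/-- Conjugating by the involution moves the fixed point to `0` without changing the multiplier, and
the Schwarz lemma applies. In the equality case the conjugated map is a rotation, so `φ` is a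
composition of three bijections of the disc. -/
theorem norm_deriv_le_one_and_isAutomorphism (φ : AnalyticSelfMap) {a : ℂ} (ha : ‖a‖ < 1)
    (hfix : φ a = a) : ‖deriv φ a‖ ≤ 1 ∧ (‖deriv φ a‖ = 1 → φ.IsAutomorphism) := by
  have h0 : ‖(0 : ℂ)‖ < 1 := by simp
  have hφ {z : ℂ} (hz : ‖z‖ < 1) : ‖φ z‖ < 1 := by
    simpa using φ.mapsTo (x := z) (by simpa using hz)
  set ψ : ℂ → ℂ := fun z => discInvolution a (φ (discInvolution a z)) with hψ
  have hψ0 : ψ 0 = 0 := by simp [hψ, discInvolution_zero, hfix, discInvolution_self]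
  have hmaps : MapsTo ψ (ball 0 1) (closedBall (ψ 0) 1) := by
    intro z hz
    rw [hψ0]
    have hz : ‖z‖ < 1 := by simpa using hz
    simpa using (norm_discInvolution_lt ha (hφ (norm_discInvolution_lt ha hz))).le
  have hφd {z : ℂ} (hz : ‖z‖ < 1) : HasDerivAt φ (deriv φ z) z :=
    (φ.differentiableOn.differentiableAt (isOpen_ball.mem_nhds (by simpa using hz))).hasDerivAt
  have hderiv {z : ℂ} (hz : ‖z‖ < 1) := (hasDerivAt_discInvolution ha
    (hφ (norm_discInvolution_lt ha hz))).comp z ((hφd (norm_discInvolution_lt ha hz)).comp z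
      (hasDerivAt_discInvolution ha hz))
  have hdiff : DifferentiableOn ℂ ψ (ball 0 1) := fun z hz =>
    (hderiv (by simpa using hz)).differentiableAt.differentiableWithinAt
  have hd0 : deriv ψ 0 = deriv φ a := by
    have h := (hderiv h0).deriv
    have h2 := one_sub_conj_mul_ne_zero ha ha
    refine h.trans ?_
    simp only [discInvolution_zero, hfix, mul_zero, sub_zero]
    field_simp
  have hle := norm_deriv_le_one_of_mapsTo_ball hdiff hmaps one_pos
  rw [hd0] at hle
  refine ⟨hle, fun h1 => ?_⟩
  have haff := affine_of_mapsTo_ball_of_norm_dslope_eq_div hdiff hmaps (z₀ := 0) (by simp)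
    (by rw [dslope_same, hd0, h1, div_one])
  set l := deriv φ a with hl
  have hl0 : l ≠ 0 := by intro h; simp [h] at h1
  have hrot {z : ℂ} (hz : ‖z‖ < 1) : ψ z = z * l := by
    have := haff (show z ∈ ball (0 : ℂ) 1 by simpa using hz)
    simpa [hψ0, dslope_same, hd0] using this
  have hform {z : ℂ} (hz : ‖z‖ < 1) : φ z = discInvolution a (discInvolution a z * l) := by
    rw [← hrot (norm_discInvolution_lt ha hz), hψ]
    simp only
    rw [discInvolution_discInvolution ha hz, discInvolution_discInvolution ha (hφ hz)]
  have hrotlt {z c : ℂ} (hc : ‖c‖ = 1) (hz : ‖z‖ < 1) : ‖z * c‖ < 1 := by rwa [norm_mul, hc, mul_one]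
  refine ⟨φ.mapsTo, ?_, ?_⟩
  · intro x hx y hy hxy
    have hx : ‖x‖ < 1 := by simpa using hx
    have hy : ‖y‖ < 1 := by simpa using hy
    rw [hform hx, hform hy] at hxy
    have h3 := congrArg (discInvolution a) hxy
    rw [discInvolution_discInvolution ha (hrotlt h1 (norm_discInvolution_lt ha hx)),
      discInvolution_discInvolution ha (hrotlt h1 (norm_discInvolution_lt ha hy))] at h3
    have h4 := congrArg (discInvolution a) (mul_right_cancel₀ hl0 h3)
    rwa [discInvolution_discInvolution ha hx, discInvolution_discInvolution ha hy] at h4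
  · intro y hy
    have hy : ‖y‖ < 1 := by simpa using hy
    have h2 : ‖l⁻¹‖ = 1 := by rw [norm_inv, h1, inv_one]
    have h3 := hrotlt h2 (norm_discInvolution_lt ha hy)
    refine ⟨discInvolution a (discInvolution a y * l⁻¹), ?_, ?_⟩
    · simpa using norm_discInvolution_lt ha h3
    · rw [hform (norm_discInvolution_lt ha h3), discInvolution_discInvolution ha h3,
        inv_mul_cancel_right₀ hl0, discInvolution_discInvolution ha hy]

/-! ### Reproducing kernels and Taylor functionals -/

/-- The kernel is the function with Taylor coefficients `conj w ^ n`: its series is geometric, and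
its coefficientwise inner product with `f` is the Taylor series of `f` at `w`. -/
theorem exists_reproducingKernel {w : ℂ} (hw : ‖w‖ < 1) :
    ∃ K : H2, (∀ z : ℂ, ‖z‖ < 1 → K z = (1 - conj w * z)⁻¹) ∧ ∀ f : H2, inner ℂ K f = f w := by
  have hmem : Memℓp (fun n : ℕ => conj w ^ n) 2 := by
    refine (memℓp_gen_iff (by norm_num)).2 ?_
    have h := summable_geometric_of_lt_one (r := ‖w‖ ^ 2) (by positivity)
      (by nlinarith [norm_nonneg w])
    simpa [← pow_mul, mul_comm] using h
  obtain ⟨K, hK⟩ := H2.exists_coeffs_eq ⟨fun n => conj w ^ n, hmem⟩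
  have hc (n : ℕ) : taylorCoeff K n = conj w ^ n := by
    rw [← H2.coeffs_apply, hK]
  refine ⟨K, fun z hz => ?_, fun f => ?_⟩
  · have h1 := hasSum_taylorCoeff K.differentiableOn (z := z) (by simpa using hz)
    simp only [hc, ← mul_pow] at h1
    refine h1.unique (hasSum_geometric_of_norm_lt_one ?_)
    rw [norm_mul, RCLike.norm_conj]
    nlinarith [norm_nonneg w, norm_nonneg z]
  · rw [H2.inner_eq_coeffs, lp.inner_eq_tsum,
      ← (hasSum_taylorCoeff f.differentiableOn (z := w) (by simpa using hw)).tsum_eq]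
    refine tsum_congr fun n => ?_
    rw [H2.coeffs_apply, H2.coeffs_apply, hc]
    simp

/-- The reproducing kernel `z ↦ (1 - w̄ z)⁻¹` of the Hardy space. -/
noncomputable def reproducingKernel {w : ℂ} (hw : ‖w‖ < 1) : H2 :=
  (exists_reproducingKernel hw).choose

theorem reproducingKernel_apply {w z : ℂ} (hw : ‖w‖ < 1) (hz : ‖z‖ < 1) :
    reproducingKernel hw z = (1 - conj w * z)⁻¹ :=
  (exists_reproducingKernel hw).choose_spec.1 z hz

theorem inner_reproducingKernel {w : ℂ} (hw : ‖w‖ < 1) (f : H2) :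
    inner ℂ (reproducingKernel hw) f = f w :=
  (exists_reproducingKernel hw).choose_spec.2 f

/-- Cauchy–Schwarz against the kernel, whose squared norm is its own value at `w`. -/
theorem norm_apply_le (f : H2) {w : ℂ} (hw : ‖w‖ < 1) :
    ‖f w‖ ≤ √(1 - ‖w‖ ^ 2)⁻¹ * ‖f‖ := by
  have h1 : ‖reproducingKernel hw‖ ^ 2 = (1 - ‖w‖ ^ 2)⁻¹ := by
    have h := inner_self_eq_norm_sq_to_K (𝕜 := ℂ) (reproducingKernel hw)
    rw [inner_reproducingKernel, reproducingKernel_apply hw hw, Complex.conj_mul'] at h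
    have h2 : (((1 - ‖w‖ ^ 2)⁻¹ : ℝ) : ℂ) = ((‖reproducingKernel hw‖ ^ 2 : ℝ) : ℂ) := by
      push_cast
      exact h
    exact (Complex.ofReal_injective h2).symm
  rw [← inner_reproducingKernel hw, ← h1, Real.sqrt_sq (norm_nonneg _)]
  exact norm_inner_le_norm _ _

theorem analyticAt_apply (f : H2) {z : ℂ} (hz : ‖z‖ < 1) : AnalyticAt ℂ f z :=
  f.differentiableOn.analyticAt (isOpen_ball.mem_nhds (by simpa using hz))

theorem analyticAt_comp_apply (f : H2) {g : ℂ → ℂ} (hg : AnalyticAt ℂ g 0) (h0 : ‖g 0‖ < 1) :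
    AnalyticAt ℂ (fun w => f (g w)) 0 :=
  (analyticAt_apply f h0).comp hg

/-- The Taylor coefficients of `f ∘ g` at `0` depend continuously on `f`. -/
theorem exists_inner_eq_taylorCoeff {g : ℂ → ℂ} (hg : AnalyticAt ℂ g 0) (h0 : ‖g 0‖ < 1) (n : ℕ) :
    ∃ v : H2, ∀ f : H2, inner ℂ v f = taylorCoeff (fun w => f (g w)) n := by
  obtain ⟨R, hR0, hR1⟩ := exists_between h0
  have hev : ∀ᶠ w in 𝓝 (0 : ℂ), AnalyticAt ℂ g w ∧ ‖g w‖ < R :=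
    hg.eventually_analyticAt.and (hg.continuousAt.norm.eventually_lt continuousAt_const hR0)
  obtain ⟨r, hr, hball⟩ := nhds_basis_closedBall.eventually_iff.1 hev
  have hdisc (f : H2) : DiffContOnCl ℂ (fun w => f (g w)) (ball 0 r) := by
    refine DifferentiableOn.diffContOnCl fun w hw => ?_
    rw [closure_ball _ hr.ne'] at hw
    obtain ⟨h1, h2⟩ := hball hw
    exact ((analyticAt_apply f (h2.trans hR1)).comp h1).differentiableAt.differentiableWithinAt
  -- Cauchy's estimate on the circle of radius `r`, where `g` stays in the disc of radius `R < 1`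
  -- and point evaluations are uniformly bounded.
  have hbound (f : H2) : ‖taylorCoeff (fun w => f (g w)) n‖
      ≤ √(1 - R ^ 2)⁻¹ / r ^ n * ‖f‖ := by
    have h1 := norm_iteratedDeriv_le_of_forall_mem_sphere_norm_le n hr (hdisc f)
      (C := √(1 - R ^ 2)⁻¹ * ‖f‖) fun w hw => by
        have h2 := (hball (sphere_subset_closedBall hw)).2
        refine (norm_apply_le f (h2.trans hR1)).trans ?_
        have h3 : 0 < 1 - R ^ 2 := by nlinarith [norm_nonneg (g w)]
        gcongr
    have h2 : (0 : ℝ) < n.factorial := by exact_mod_cast n.factorial_pos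
    rw [taylorCoeff, norm_mul, norm_inv, Complex.norm_natCast, inv_mul_le_iff₀ h2]
    refine h1.trans_eq ?_
    ring
  let L : H2 →L[ℂ] ℂ := LinearMap.mkContinuous
    { toFun := fun f => taylorCoeff (fun w => f (g w)) n
      map_add' := fun f k => taylorCoeff_add_of_analyticAt (analyticAt_comp_apply f hg h0)
        (analyticAt_comp_apply k hg h0) n
      map_smul' := fun c f => taylorCoeff_const_mul (analyticAt_comp_apply f hg h0) c n }
    (√(1 - R ^ 2)⁻¹ / r ^ n) hbound
  exact ⟨(InnerProductSpace.toDual ℂ H2).symm L, fun f => InnerProductSpace.toDual_symm_apply⟩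

/-! ### Linear fractional maps with an attracting fixed point -/

/-- The linear fractional chart `w ↦ a + w / (1 - h w)` around `a`. -/
noncomputable def fractionalChart (a h w : ℂ) : ℂ := a + w / (1 - h * w)

theorem fractionalChart_zero (a h : ℂ) : fractionalChart a h 0 = a := by simp [fractionalChart]

theorem eventually_one_sub_mul_ne_zero (h : ℂ) : ∀ᶠ w in 𝓝 (0 : ℂ), 1 - h * w ≠ 0 := by
  have : ContinuousAt (fun w => 1 - h * w) 0 := by fun_prop
  exact this.eventually_ne (by simp)

theorem analyticAt_fractionalChart (a h : ℂ) : AnalyticAt ℂ (fractionalChart a h) 0 := by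
  refine analyticAt_const.add (analyticAt_id.div ?_ (by simp))
  exact analyticAt_const.sub (analyticAt_const.mul analyticAt_id)

theorem eventually_norm_fractionalChart_lt {a : ℂ} (ha : ‖a‖ < 1) (h : ℂ) :
    ∀ᶠ w in 𝓝 (0 : ℂ), ‖fractionalChart a h w‖ < 1 :=
  (analyticAt_fractionalChart a h).continuousAt.norm.eventually_lt continuousAt_const
    (by simpa [fractionalChart_zero])

/-- In the chart `fractionalChart a h`, the map `φ` is multiplication by `l`. -/
def AnalyticSelfMap.IsLinearizedBy (φ : AnalyticSelfMap) (a h l : ℂ) : Prop :=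
  ∀ z : ℂ, ‖z‖ < 1 → 1 + (1 - l) * h * (z - a) ≠ 0 ∧
    φ z = a + l * (z - a) / (1 + (1 - l) * h * (z - a))

/-- Substituting `z - a = w / (1 - h w)` turns the denominator of `φ` into `(1 - h l w) / (1 - h
w)`, and `1 - h w` cancels. Only germs are compared, as the chart need not stay in the disc for
large `w`. -/
theorem AnalyticSelfMap.IsLinearizedBy.eventually_chart {φ : AnalyticSelfMap} {a h l : ℂ}
    (hφ : φ.IsLinearizedBy a h l) (ha : ‖a‖ < 1) :
    ∀ᶠ w in 𝓝 (0 : ℂ), φ (fractionalChart a h w) = fractionalChart a h (l * w) := by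
  filter_upwards [eventually_norm_fractionalChart_lt ha h, eventually_one_sub_mul_ne_zero h,
    eventually_one_sub_mul_ne_zero (h * l)] with w h1 h2 h3
  obtain ⟨h4, h5⟩ := hφ _ h1
  rw [h5]
  simp only [fractionalChart, add_sub_cancel_left] at h4 ⊢
  have e : 1 + (1 - l) * h * (w / (1 - h * w)) = (1 - h * l * w) / (1 - h * w) := by
    rw [eq_div_iff h2, add_mul, mul_assoc _ (w / _), div_mul_cancel₀ _ h2]
    ring
  rw [e, ← mul_assoc h l w]
  congr 1
  rw [mul_div_assoc', div_div_div_cancel_right₀ h2]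

/-- This makes the vectors representing the Taylor functionals eigenvectors of the adjoint. -/
theorem AnalyticSelfMap.IsLinearizedBy.taylorCoeff_compOp {φ : AnalyticSelfMap} {a h l : ℂ}
    (hφ : φ.IsLinearizedBy a h l) (ha : ‖a‖ < 1) (f : H2) (n : ℕ) :
    taylorCoeff (fun w => compOp φ f (fractionalChart a h w)) n =
      l ^ n * taylorCoeff (fun w => f (fractionalChart a h w)) n := by
  rw [← taylorCoeff_comp_const_mul (analyticAt_comp_apply f (analyticAt_fractionalChart a h)
    (by rwa [fractionalChart_zero]))]
  refine taylorCoeff_congr ?_ n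
  filter_upwards [hφ.eventually_chart ha, eventually_norm_fractionalChart_lt ha h] with w h1 h2
  rw [compOp_apply φ f (by simpa using h2), h1]

/-- In the chart an eigenfunction is homogeneous under scaling by `l`, hence a monomial near `a`;
the identity theorem spreads this over the disc. The denominator is cleared because `1 + h (z - a)`
is not yet known to be zero-free there. -/
theorem AnalyticSelfMap.IsLinearizedBy.eigenfunction {φ : AnalyticSelfMap} {a h l : ℂ}
    (hφ : φ.IsLinearizedBy a h l) (ha : ‖a‖ < 1) (hl0 : l ≠ 0) (hl1 : ‖l‖ < 1) {f : H2} {n : ℕ}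
    (hf : compOp φ f = l ^ n • f) :
    ∃ d : ℂ, ∀ z : ℂ, ‖z‖ < 1 → f z * (1 + h * (z - a)) ^ n = d * (z - a) ^ n := by
  have h0 : ‖fractionalChart a h 0‖ < 1 := by rwa [fractionalChart_zero]
  have h1 := eventually_eq_monomial (n := n)
    (analyticAt_comp_apply f (analyticAt_fractionalChart a h) h0) hl0 hl1 (by
      filter_upwards [hφ.eventually_chart ha, eventually_norm_fractionalChart_lt ha h] with w h1 h2
      rw [← h1, ← compOp_apply φ f (by simpa using h2), hf, H2.smul_apply])
  set d := taylorCoeff (fun w => f (fractionalChart a h w)) n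
  refine ⟨d, fun z hz => ?_⟩
  have hz : z ∈ ball (0 : ℂ) 1 := by simpa using hz
  have ha' : a ∈ ball (0 : ℂ) 1 := by simpa using ha
  have hd1 : DifferentiableOn ℂ (fun z => f z * (1 + h * (z - a)) ^ n) (ball 0 1) :=
    f.differentiableOn.mul (by fun_prop)
  have hd2 : DifferentiableOn ℂ (fun z => d * (z - a) ^ n) (ball 0 1) := by fun_prop
  refine (hd1.analyticOnNhd isOpen_ball).eqOn_of_preconnected_of_eventuallyEq
    (hd2.analyticOnNhd isOpen_ball) (convex_ball _ _).isPreconnected ha' ?_ hz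
  have hne : ContinuousAt (fun z => 1 + h * (z - a)) a := by fun_prop
  have hne' : ∀ᶠ z in 𝓝 a, 1 + h * (z - a) ≠ 0 := hne.eventually_ne (by simp)
  have ht : Tendsto (fun z => (z - a) / (1 + h * (z - a))) (𝓝 a) (𝓝 0) := by
    have : ContinuousAt (fun z => (z - a) / (1 + h * (z - a))) a :=
      ContinuousAt.div (by fun_prop) hne (by simp)
    simpa [ContinuousAt] using this
  filter_upwards [hne', ht.eventually h1] with z h2 h3
  -- The map `z ↦ (z - a) / (1 + h (z - a))` inverts the chart.
  have e : fractionalChart a h ((z - a) / (1 + h * (z - a))) = z := by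
    have : 1 - h * ((z - a) / (1 + h * (z - a))) = 1 / (1 + h * (z - a)) := by
      rw [eq_div_iff h2, sub_mul, mul_assoc, div_mul_cancel₀ _ h2]; ring
    rw [fractionalChart, this, div_div_div_cancel_right₀ h2]
    ring
  rw [e] at h3
  rw [h3, div_pow, mul_assoc, div_mul_cancel₀ _ (pow_ne_zero n h2)]

theorem AnalyticSelfMap.IsGivenBy.apply_eq {φ : AnalyticSelfMap}
    {A : Matrix.GeneralLinearGroup (Fin 2) ℂ} (hA : φ.IsGivenBy A) {z : ℂ} (hz : ‖z‖ < 1) :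
    A 1 0 * z + A 1 1 ≠ 0 ∧ φ z = (A 0 0 * z + A 0 1) / (A 1 0 * z + A 1 1) := by
  have h := hA z (by simpa using hz)
  rw [OnePoint.smul_some_eq_ite] at h
  split_ifs at h with h1
  · exact absurd h (OnePoint.infty_ne_coe _)
  · exact ⟨h1, (OnePoint.coe_injective h).symm⟩

/-- With `e = γ a + δ`, the multiplier is `l = φ'(a) = det / e²`. The normalized denominator is `(γ
z + δ) / e = 1 + (γ / e)(z - a)`, which forces `(1 - l) h = γ / e`. -/
theorem AnalyticSelfMap.IsGivenBy.exists_isLinearizedBy {φ : AnalyticSelfMap}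
    {A : Matrix.GeneralLinearGroup (Fin 2) ℂ} (hA : φ.IsGivenBy A) (hφ : ¬ φ.IsAutomorphism)
    {a : ℂ} (ha : ‖a‖ < 1) (hfix : φ a = a) :
    ∃ h l : ℂ, l ≠ 0 ∧ ‖l‖ < 1 ∧ φ.IsLinearizedBy a h l ∧ (h = 0 → A 1 0 = 0) := by
  have hdet : A 0 0 * A 1 1 - A 0 1 * A 1 0 ≠ 0 := by
    rw [← Matrix.det_fin_two]; exact A.det_ne_zero
  have happ {z : ℂ} (hz : ‖z‖ < 1) := hA.apply_eq hz
  obtain ⟨he, hae⟩ := happ ha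
  rw [hfix, eq_div_iff he] at hae
  generalize A 0 0 = α at *
  generalize A 0 1 = β at *
  generalize A 1 0 = γ at *
  generalize A 1 1 = δ at *
  set e := γ * a + δ with hedef
  set l := (α * δ - β * γ) / e ^ 2 with hl
  have hderiv : deriv φ a = l := by
    have h1 : HasDerivAt (fun z => (α * z + β) / (γ * z + δ)) l a := by
      have := (((hasDerivAt_id a).const_mul α).add_const β).div
        (((hasDerivAt_id a).const_mul γ).add_const δ) he
      convert! this using 1
      rw [hl]
      simp only [id]
      congr 1
      ring
    refine (h1.congr_of_eventuallyEq ?_).deriv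
    filter_upwards [isOpen_ball.mem_nhds (show a ∈ ball (0 : ℂ) 1 by simpa using ha)] with z hz
    exact (happ (by simpa using hz)).2
  obtain ⟨hle, hauto⟩ := norm_deriv_le_one_and_isAutomorphism φ ha hfix
  rw [hderiv] at hle hauto
  have hl1 : ‖l‖ < 1 := hle.lt_of_ne fun h => hφ (hauto h)
  have hl1' : 1 - l ≠ 0 := by
    intro h
    rw [← sub_eq_zero.1 h, norm_one] at hl1
    exact lt_irrefl _ hl1
  refine ⟨γ / e / (1 - l), l, div_ne_zero hdet (pow_ne_zero 2 he), hl1, fun z hz => ?_, fun h => ?_⟩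
  · obtain ⟨h1, h2⟩ := happ hz
    have h3 : 1 + (1 - l) * (γ / e / (1 - l)) * (z - a) = (γ * z + δ) / e := by
      rw [mul_div_cancel₀ _ hl1', eq_div_iff he, add_mul, mul_right_comm, div_mul_cancel₀ _ he,
        hedef]
      ring
    have h4 : l * e = α - γ * a := by
      rw [hl, div_mul_eq_mul_div, div_eq_iff (pow_ne_zero 2 he)]
      linear_combination (γ * e) * hae
    rw [h3]
    refine ⟨div_ne_zero h1 he, ?_⟩
    rw [h2, div_div_eq_mul_div, mul_right_comm, h4, div_eq_iff h1, add_mul, div_mul_cancel₀ _ h1]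
    linear_combination -hae
  · simpa [he, hl1'] using h

/-! ### Taylor coefficients of the kernels in the chart -/

theorem taylorCoeff_of_eventuallyEq_quadratic {F G : ℂ → ℂ} {c₀ c₁ c₂ : ℂ} (hG : AnalyticAt ℂ G 0)
    (h : ∀ᶠ w in 𝓝 (0 : ℂ), F w = c₀ + c₁ * w + c₂ * w ^ 2 + w ^ 3 * G w) :
    taylorCoeff F 0 = c₀ ∧ taylorCoeff F 1 = c₁ ∧ taylorCoeff F 2 = c₂ := by
  have h2 : AnalyticAt ℂ (fun w => c₂ + w * G w) 0 := analyticAt_const.add (analyticAt_id.mul hG)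
  have h1 : AnalyticAt ℂ (fun w => c₁ + w * (c₂ + w * G w)) 0 :=
    analyticAt_const.add (analyticAt_id.mul h2)
  have h0 : ∀ᶠ w in 𝓝 (0 : ℂ), F w = c₀ + w * (c₁ + w * (c₂ + w * G w)) := by
    filter_upwards [h] with w hw
    rw [hw]; ring
  refine ⟨?_, ?_, ?_⟩
  · rw [taylorCoeff_zero, h0.self_of_nhds, zero_mul, add_zero]
  · rw [taylorCoeff_succ_of_eventuallyEq h1 h0, taylorCoeff_zero, zero_mul, add_zero]
  · rw [taylorCoeff_succ_of_eventuallyEq h1 h0,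
      taylorCoeff_succ_of_eventuallyEq h2 (Eventually.of_forall fun _ => rfl), taylorCoeff_zero,
      zero_mul, add_zero]

theorem eventually_sub_mul_ne_zero {Q : ℂ} (hQ : Q ≠ 0) (m : ℂ) :
    ∀ᶠ w in 𝓝 (0 : ℂ), Q - m * w ≠ 0 := by
  have : ContinuousAt (fun w => Q - m * w) 0 := by fun_prop
  exact this.eventually_ne (by simpa)

theorem analyticAt_sub_mul (Q m : ℂ) : AnalyticAt ℂ (fun w => Q - m * w) 0 :=
  analyticAt_const.sub (analyticAt_const.mul analyticAt_id)

/-- With `Q = 1 - z̄ a` and `m = h Q + z̄`, the kernel in the chart is `(1 - h w) / (Q - m w)`. As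
functions of `z`, the conjugates of these coefficients are the vectors representing the Taylor
functionals. -/
theorem taylorCoeff_kernel_chart {a z : ℂ} (ha : ‖a‖ < 1) (hz : ‖z‖ < 1) (h : ℂ) :
    taylorCoeff (fun w => reproducingKernel hz (fractionalChart a h w)) 0
        = 1 / (1 - conj z * a) ∧
      taylorCoeff (fun w => reproducingKernel hz (fractionalChart a h w)) 1
        = conj z / (1 - conj z * a) ^ 2 ∧
      taylorCoeff (fun w => reproducingKernel hz (fractionalChart a h w)) 2
        = conj z * (h * (1 - conj z * a) + conj z) / (1 - conj z * a) ^ 3 := by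
  have hQ := one_sub_conj_mul_ne_zero hz ha
  generalize hQdef : 1 - conj z * a = Q at *
  set m := h * Q + conj z with hm
  refine taylorCoeff_of_eventuallyEq_quadratic
    -- The remainder of the geometric expansion after the quadratic term.
    (G := fun w => conj z * m ^ 2 / Q ^ 3 / (Q - m * w))
    (analyticAt_const.div (analyticAt_sub_mul Q m) (by simpa)) ?_
  filter_upwards [eventually_norm_fractionalChart_lt ha h, eventually_one_sub_mul_ne_zero h,
    eventually_sub_mul_ne_zero hQ m] with w h1 h2 h3
  rw [reproducingKernel_apply hz h1]
  have e : 1 - conj z * fractionalChart a h w = (Q - m * w) / (1 - h * w) := by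
    rw [fractionalChart, eq_div_iff h2, sub_mul, mul_assoc, add_mul a, div_mul_cancel₀ _ h2, hm,
      ← hQdef]
    ring
  rw [e, inv_div]
  have e2 : (1 - h * w) * Q ^ 3 = (Q ^ 2 + conj z * Q * w + conj z * m * w ^ 2) * (Q - m * w)
      + w ^ 3 * (conj z * m ^ 2) := by
    rw [hm]; ring
  rw [div_eq_iff h3]
  have e3 : 1 - h * w = ((1 - h * w) * Q ^ 3) / Q ^ 3 := by field_simp
  have e4 : w ^ 3 * (conj z * m ^ 2 / Q ^ 3 / (Q - m * w)) * (Q - m * w)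
      = w ^ 3 * (conj z * m ^ 2) / Q ^ 3 := by
    rw [mul_assoc, div_mul_cancel₀ _ h3, mul_div_assoc']
  rw [e3, e2, add_mul _ (w ^ 3 * _), e4]
  field_simp

/-- The function `v` represents `f ↦ f'(a)`. In the chart it is `(a + (1 - a h) w)(1 - h w) / (Q - m
w)²`, which is expanded to second order. -/
theorem taylorCoeff_derivKernel_chart {a : ℂ} (ha : ‖a‖ < 1) (h : ℂ) {v : ℂ → ℂ}
    (hv : ∀ z : ℂ, ‖z‖ < 1 → v z = z / (1 - conj a * z) ^ 2) :
    taylorCoeff (fun w => v (fractionalChart a h w)) 1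
        = (1 + conj a * a) / (1 - conj a * a) ^ 3 ∧
      taylorCoeff (fun w => v (fractionalChart a h w)) 2
        = conj a * (2 + conj a * a) / (1 - conj a * a) ^ 4
          + h * (1 + conj a * a) / (1 - conj a * a) ^ 3 := by
  have hQ := one_sub_conj_mul_ne_zero ha ha
  generalize conj a = b at *
  generalize hQdef : 1 - b * a = Q at *
  set m := h * Q + b with hm
  set c₀ := a / Q ^ 2 with hc₀
  set c₁ := (1 + b * a) / Q ^ 3 with hc₁
  set c₂ := b * (2 + b * a) / Q ^ 4 + h * (1 + b * a) / Q ^ 3 with hc₂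
  have hba : b * a = 1 - Q := by rw [← hQdef]; ring
  -- `e₀`, `e₁`, `e₂` match the coefficients of `1`, `w`, `w²` in the numerator with those of `(c₀ +
  -- c₁ w + c₂ w²)(Q - m w)²`; the excess of higher order goes into `G`.
  have e₀ : c₀ * Q ^ 2 = a := by rw [hc₀]; field_simp
  have e₁ : c₁ * Q ^ 2 - 2 * c₀ * Q * m = 1 - 2 * a * h := by
    rw [hc₀, hc₁, hm]; field_simp
    linear_combination (-1 : ℂ) * hba
  have e₂ : c₂ * Q ^ 2 - 2 * c₁ * Q * m + c₀ * m ^ 2 = -(1 - a * h) * h := by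
    rw [hc₀, hc₁, hc₂, hm]; field_simp
    linear_combination (h * Q) * hba
  refine (taylorCoeff_of_eventuallyEq_quadratic (c₀ := c₀)
    (G := fun w => (2 * c₂ * Q * m - c₁ * m ^ 2 - c₂ * m ^ 2 * w) / (Q - m * w) ^ 2)
    ((analyticAt_sub_mul _ _).div ((analyticAt_sub_mul Q m).pow 2) (by simpa)) ?_).2
  filter_upwards [eventually_norm_fractionalChart_lt ha h, eventually_one_sub_mul_ne_zero h,
    eventually_sub_mul_ne_zero hQ m] with w h1 h2 h3
  rw [hv _ h1]
  have e : 1 - b * fractionalChart a h w = (Q - m * w) / (1 - h * w) := by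
    rw [fractionalChart, eq_div_iff h2, sub_mul, mul_assoc, add_mul a, div_mul_cancel₀ _ h2, hm,
      ← hQdef]
    ring
  have e' : fractionalChart a h w = (a + (1 - a * h) * w) / (1 - h * w) := by
    rw [fractionalChart, eq_div_iff h2, add_mul, div_mul_cancel₀ _ h2]
    ring
  rw [e, e', div_pow, div_div_div_eq, div_eq_iff (mul_ne_zero h2 (pow_ne_zero 2 h3))]
  have e4 := div_mul_cancel₀ (2 * c₂ * Q * m - c₁ * m ^ 2 - c₂ * m ^ 2 * w) (pow_ne_zero 2 h3)
  generalize (2 * c₂ * Q * m - c₁ * m ^ 2 - c₂ * m ^ 2 * w) / (Q - m * w) ^ 2 = q at *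
  linear_combination (-(1 - h * w)) * e₀ - (1 - h * w) * w * e₁ - (1 - h * w) * w ^ 2 * e₂
    - (1 - h * w) * w ^ 3 * e4

/-! ### The algebra of the Gram matrices -/

/-- The relations between the Gram matrices of the eigenfunctions of `T` and of `T*` for the
eigenvalues `1`, `l`, `l²` are inconsistent if `h ≠ 0`. -/
theorem gram_relations_inconsistent {a b h H d₀ D₀ d₁ D₁ d₂ κ k ρ Δ t m : ℂ}
    (hκ : κ = 1 - a * h) (hk : k = 1 - b * H) (hρ : ρ = 1 - b * a) (hΔ : Δ = κ * k - h * H)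
    (ht : t = H + a * k) (hm : m = h * ρ + b)
    (ha0 : a ≠ 0) (hb0 : b ≠ 0) (h0 : h ≠ 0) (hH0 : H ≠ 0) (hκ0 : κ ≠ 0) (hk0 : k ≠ 0)
    (e00 : D₀ * d₀ * ρ = 1) (e01 : D₀ * d₁ * a * ρ ^ 2 = -b * κ)
    (e10 : d₀ * D₁ * b * ρ ^ 2 = -a * k) (e02 : D₀ * d₂ * a ^ 2 * ρ ^ 3 = b * m * κ ^ 2)
    (e11 : D₁ * d₁ * (-a * k * Δ + t * κ) * ρ ^ 3 = H * (1 + b * a) * (κ * k * Δ))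
    (e12 : D₁ * d₂ * (a ^ 2 * k * Δ ^ 2 - t ^ 2 * κ ^ 2) * ρ ^ 4
      = H * (b * (2 + b * a) + h * ρ * (1 + b * a)) * (κ ^ 2 * k * Δ ^ 2)) : False := by
  have hab : a * b ≠ 0 := mul_ne_zero ha0 hb0
  -- The rank-one relation `(D₁ d₁)(D₀ d₀) = (D₀ d₁)(D₁ d₀)` eliminates the scalars; `f12` does the
  -- same with `d₂`.
  have f11 : D₁ * d₁ * ρ ^ 3 = κ * k := by
    refine mul_left_cancel₀ hab ?_
    linear_combination (d₀ * D₁ * b * ρ ^ 2) * e01 - b * κ * e10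
      - a * b * (D₁ * d₁ * ρ ^ 3) * e00
  have f12 : D₁ * d₂ * ρ ^ 4 * a = -(k * m * κ ^ 2) := by
    refine mul_left_cancel₀ hab ?_
    linear_combination (D₀ * d₂ * a ^ 2 * ρ ^ 3) * e10 - a * k * e02
      - a * b * (D₁ * d₂ * ρ ^ 4 * a) * e00
  have g11 : t * κ = Δ * (H + a) := by
    refine mul_left_cancel₀ (mul_ne_zero hκ0 hk0) ?_
    linear_combination e11 - (-a * k * Δ + t * κ) * f11 + κ * k * Δ * a * hk
  have hR : κ * b * H + h * H + h * a = 0 := by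
    refine mul_left_cancel₀ hH0 ?_
    rw [ht, hΔ] at g11
    rw [hκ, hk] at *
    linear_combination g11
  -- `Δ = κ - (κ b H + h H)`, which by `hR` equals `κ + a h = 1`.
  have hΔ1 : Δ = 1 := by
    rw [hΔ, hk, hκ]; rw [hκ] at hR
    linear_combination -hR
  rw [hΔ1] at g11 e12
  have g12 : m * (H + 2 * a + a ^ 2 * b) = a * (b * (2 + b * a) + h * ρ * (1 + b * a)) := by
    refine mul_left_cancel₀ (mul_ne_zero hH0 (mul_ne_zero (pow_ne_zero 2 hκ0) hk0)) ?_
    have e : a ^ 2 * k * 1 ^ 2 - t ^ 2 * κ ^ 2 = -(H * (H + 2 * a + a ^ 2 * b)) := by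
      linear_combination (-(t * κ) - (H + a)) * g11 + a ^ 2 * hk
    rw [e] at e12
    linear_combination a * e12 + (H * (H + 2 * a + a ^ 2 * b)) * f12
  -- After expansion, `hR` and `g12` differ exactly by `a² b h`.
  refine mul_ne_zero (mul_ne_zero (pow_ne_zero 2 ha0) hb0) h0 ?_
  rw [hm, hρ] at g12
  rw [hκ] at hR
  linear_combination hR - g12

/-! ### Complex symmetry forces the map to be affine -/

/-- The linear factor may vanish at `0` itself, so the value there is obtained as a limit over the
punctured neighbourhood. -/
theorem apply_zero_eq_zero_of_mul_eq_zero (f : H2) {p q : ℂ} (hpq : p ≠ 0 ∨ q ≠ 0)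
    (h : ∀ z : ℂ, ‖z‖ < 1 → f z * (p + q * z) = 0) : f 0 = 0 := by
  have h1 : Tendsto f (𝓝[≠] 0) (𝓝 (f 0)) :=
    (analyticAt_apply f (by simp)).continuousAt.tendsto.mono_left nhdsWithin_le_nhds
  have hne : ∀ᶠ z in 𝓝[≠] (0 : ℂ), p + q * z ≠ 0 := by
    by_cases hp : p = 0
    · filter_upwards [self_mem_nhdsWithin] with z hz
      simpa [hp] using ⟨hpq.resolve_left (not_not.2 hp), hz⟩
    · have : ContinuousAt (fun z => p + q * z) 0 := by fun_prop
      exact (this.eventually_ne (by simpa)).filter_mono nhdsWithin_le_nhds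
  refine tendsto_nhds_unique_of_eventuallyEq h1 tendsto_const_nhds ?_
  filter_upwards [hne, nhdsWithin_le_nhds (isOpen_ball.mem_nhds (mem_ball_self one_pos))]
    with z hz hz1
  exact (mul_eq_zero.1 (h z (by simpa using hz1))).resolve_right hz

/-- A linear fractional function with a simple pole belongs to `H²(D)` only if its pole lies outside
the closed disc. -/
theorem norm_lt_one_of_mul_eq (f : H2) {s t₀ t₁ : ℂ} (ht : t₁ ≠ 0)
    (h : ∀ z : ℂ, ‖z‖ < 1 → f z * (1 - s * z) = t₀ * (1 - s * z) + t₁ * z) : ‖s‖ < 1 := by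
  -- From degree 1 on the coefficients are geometric with ratio `s`, so square summability forces
  -- `‖s‖ < 1`.
  have hc (n : ℕ) : taylorCoeff f (n + 1) = t₁ * s ^ n := by
    have hA : AnalyticAt ℂ (fun z => t₁ / (1 - s * z)) 0 :=
      analyticAt_const.div (analyticAt_sub_mul 1 s) (by simp)
    rw [taylorCoeff_succ_of_eventuallyEq (c := t₀) hA]
    · refine taylorCoeff_eq_of_eventually_hasSum (c := fun n => t₁ * s ^ n) ?_ n
      have hn : ContinuousAt (fun z => ‖s * z‖) 0 := by fun_prop
      filter_upwards [hn.eventually_lt (continuousAt_const (y := (1 : ℝ))) (by simp)] with z hz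
      rw [div_eq_mul_inv]
      refine ((hasSum_geometric_of_norm_lt_one hz).mul_left t₁).congr_fun fun n => ?_
      rw [mul_pow]
      ring
    · filter_upwards [eventually_one_sub_mul_ne_zero s,
        isOpen_ball.mem_nhds (mem_ball_self one_pos)] with z hz hz1
      refine mul_right_cancel₀ hz ?_
      rw [h z (by simpa using hz1), add_mul, mul_assoc z, div_mul_cancel₀ _ hz, mul_comm z]
  have hs := (summable_nat_add_iff 1).2 f.summable_coeff
  simp only [hc, norm_mul, norm_pow, mul_pow] at hs
  rw [summable_mul_left_iff (by simpa using ht)] at hs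
  simp only [← pow_mul, mul_comm _ 2] at hs
  simp only [pow_mul] at hs
  rw [summable_geometric_iff_norm_lt_one] at hs
  simp only [norm_pow, norm_norm] at hs
  exact (sq_lt_one_iff₀ (norm_nonneg _)).1 hs

theorem AnalyticSelfMap.IsLinearizedBy.eq_zero_of_isComplexSymmetric {φ : AnalyticSelfMap}
    {a h l : ℂ} (hφ : φ.IsLinearizedBy a h l) (ha : ‖a‖ < 1) (ha0 : a ≠ 0) (hl0 : l ≠ 0)
    (hl1 : ‖l‖ < 1) (hC : IsComplexSymmetric (compOp φ)) : h = 0 := by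
  by_contra h0
  obtain ⟨C, hC, hT⟩ := hC
  have hchart : ‖fractionalChart a h 0‖ < 1 := by rwa [fractionalChart_zero]
  choose v hv using fun n : ℕ =>
    exists_inner_eq_taylorCoeff (analyticAt_fractionalChart a h) hchart n
  have heig (n : ℕ) : compOp φ (C (v n)) = l ^ n • C (v n) :=
    hC.apply_eigenvector hT fun f => by rw [hv, hv, hφ.taylorCoeff_compOp ha]
  choose d hd using fun n : ℕ => hφ.eigenfunction ha hl0 hl1 (heig n)
  -- `C` swaps the arguments of the inner product, and pairing with `v n` reads off a Taylor
  -- coefficient.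
  have hgram (m n : ℕ) : inner ℂ (C (v m)) (C (v n))
      = taylorCoeff (fun w => v m (fractionalChart a h w)) n := by
    rw [hC.isometric, hv]
  have hvapply (n : ℕ) {z : ℂ} (hz : ‖z‖ < 1) : v n z
      = conj (taylorCoeff (fun w => reproducingKernel hz (fractionalChart a h w)) n) := by
    rw [← hv, inner_conj_symm, inner_reproducingKernel]
  -- the dual eigenvectors
  have hv0 : v 0 = reproducingKernel ha := by
    refine H2.ext fun z hz => ?_
    have hz : ‖z‖ < 1 := by simpa using hz
    rw [hvapply 0 hz, (taylorCoeff_kernel_chart ha hz h).1, reproducingKernel_apply ha hz]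
    simp [mul_comm]
  have hv1 (z : ℂ) (hz : ‖z‖ < 1) : v 1 z = z / (1 - conj a * z) ^ 2 := by
    rw [hvapply 1 hz, (taylorCoeff_kernel_chart ha hz h).2.1]
    simp [mul_comm]
  obtain ⟨L00, L01, L02⟩ := taylorCoeff_kernel_chart ha ha h
  obtain ⟨L11, L12⟩ := taylorCoeff_derivKernel_chart ha h hv1
  rw [← hv0, ← hgram] at L00 L01 L02
  rw [← hgram] at L11 L12
  -- the eigenfunctions of the composition operator
  have hn0 : ‖(0 : ℂ)‖ < 1 := by simp
  have hg0 : C (v 0) = d 0 • reproducingKernel hn0 := by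
    refine H2.ext fun z hz => ?_
    have hz : ‖z‖ < 1 := by simpa using hz
    rw [H2.smul_apply, reproducingKernel_apply hn0 hz]
    simpa using hd 0 z hz
  have hinner0 (f : H2) : inner ℂ (C (v 0)) f = conj (d 0) * f 0 := by
    rw [hg0, inner_smul_left, inner_reproducingKernel]
  rw [hinner0] at L00 L01 L02
  have hb0 : conj a ≠ 0 := by simpa using ha0
  have hρ0 := one_sub_conj_mul_ne_zero ha ha
  -- The (0,1) Gram entry is a multiple of this value and equals `conj a / (1 - |a|²)²`, nonzero
  -- since `a ≠ 0`.
  have hg1ne : C (v 1) 0 ≠ 0 := by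
    intro h1
    rw [h1, mul_zero, eq_comm] at L01
    exact div_ne_zero hb0 (pow_ne_zero 2 hρ0) L01
  obtain ⟨κ, hκ⟩ : ∃ κ, κ = 1 - a * h := ⟨_, rfl⟩
  have hq (z : ℂ) : 1 + h * (z - a) = κ + h * z := by rw [hκ]; ring
  simp only [hq] at hd
  have hd1 (z : ℂ) (hz : ‖z‖ < 1) : C (v 1) z * (κ + h * z) = d 1 * (z - a) := by
    simpa using hd 1 z hz
  have hd10 : d 1 ≠ 0 := by
    intro h1
    refine hg1ne (apply_zero_eq_zero_of_mul_eq_zero _ (p := κ) (Or.inr h0) fun z hz => ?_)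
    rw [hd1 z hz, h1, zero_mul]
  -- If `κ = 0`, the denominator vanishes at `0` while the numerator is `-(d 1 * a) ≠ 0` there.
  have hκ0 : κ ≠ 0 := by
    intro h1
    have := hd1 0 hn0
    rw [h1] at this
    simp [hd10, ha0] at this
  -- The pole of `C (v 1)` is `-κ / h = 1 / s`; membership in the Hardy space puts it outside the
  -- closed disc.
  obtain ⟨s, hs⟩ : ∃ s, s = -(h / κ) := ⟨_, rfl⟩
  have hsκ (z : ℂ) : 1 - s * z = (κ + h * z) / κ := by rw [hs]; field_simp; ring
  have hs1 : ‖s‖ < 1 := by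
    refine norm_lt_one_of_mul_eq (C (v 1)) (t₀ := -(d 1 * a) / κ) (t₁ := d 1 / κ ^ 2)
      (div_ne_zero hd10 (pow_ne_zero 2 hκ0)) fun z hz => ?_
    rw [hsκ, mul_div_assoc', hd1 z hz]
    field_simp
    rw [hκ]
    ring
  have hs1' : ‖conj s‖ < 1 := by rwa [RCLike.norm_conj]
  have hqne {z : ℂ} (hz : ‖z‖ < 1) : κ + h * z ≠ 0 := by
    intro h1
    have h2 := one_sub_conj_mul_ne_zero hs1' hz
    rw [Complex.conj_conj, hsκ, h1, zero_div] at h2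
    exact h2 rfl
  -- Partial fractions: `(z - a) / (κ + h z) = (1 / h)(1 - 1 / (κ + h z))`, where the constant `1`
  -- is the kernel at `0` and `1 / (κ + h z)` is `κ⁻¹` times the kernel at `conj s`.
  have hg1 : C (v 1) = (d 1 / h) • (reproducingKernel hn0 + (-κ⁻¹) • reproducingKernel hs1') := by
    refine H2.ext fun z hz => ?_
    have hz : ‖z‖ < 1 := by simpa using hz
    rw [H2.smul_apply, H2.add_apply, H2.smul_apply, reproducingKernel_apply hn0 hz,
      reproducingKernel_apply hs1' hz, Complex.conj_conj, hsκ]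
    have h1 := hqne hz
    refine mul_right_cancel₀ h1 ?_
    rw [hd1 z hz, map_zero, zero_mul, sub_zero, inv_one, inv_div, mul_assoc, add_mul,
      mul_assoc (-κ⁻¹), div_mul_cancel₀ _ h1, neg_mul, inv_mul_cancel₀ hκ0, hκ]
    field_simp
    ring
  have hinner1 (f : H2) : inner ℂ (C (v 1)) f
      = conj (d 1) / conj h * (f 0 - (conj κ)⁻¹ * f (conj s)) := by
    rw [hg1, inner_smul_left, inner_add_left, inner_smul_left, inner_reproducingKernel,
      inner_reproducingKernel]
    simp [sub_eq_add_neg]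
  rw [hinner1] at L11 L12
  -- the values of the eigenfunctions that enter the Gram matrix
  have e00 : C (v 0) 0 = d 0 := by simpa using hd 0 0 hn0
  have e10 : C (v 1) 0 * κ = -(d 1 * a) := by simpa using hd1 0 hn0
  have e20 : C (v 2) 0 * κ ^ 2 = d 2 * a ^ 2 := by simpa using hd 2 0 hn0
  have e1s := hd1 (conj s) hs1'
  have e2s := hd 2 (conj s) hs1'
  have hH0 : conj h ≠ 0 := by simpa using h0
  have hk0 : conj κ ≠ 0 := by simpa using hκ0
  have hk : conj κ = 1 - conj a * conj h := by simp [hκ]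
  have hsc : conj s = -(conj h / conj κ) := by simp [hs]
  -- The conjugated (0,1) relation supplies `d 0 * conj (d 1)`, the product needed to eliminate the
  -- scalars.
  have L01c := congrArg conj L01
  simp only [map_mul, map_div₀, map_pow, map_sub, map_one, Complex.conj_conj] at L01c
  have e10c := congrArg conj e10
  simp only [map_mul, map_neg] at e10c
  -- From here on, numbers and their conjugates are treated as independent variables; only
  -- polynomial identities are used.
  generalize C (v 0) 0 = g00 at *
  generalize C (v 1) 0 = g10 at *
  generalize C (v 2) 0 = g20 at *
  generalize C (v 1) (conj s) = P at *
  generalize C (v 2) (conj s) = R at *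
  generalize conj (d 0) = D₀ at *
  generalize conj (d 1) = D₁ at *
  generalize conj g10 = G10 at *
  rw [hsc] at e1s e2s
  clear hsc hg1
  generalize conj s = s' at *
  obtain ⟨H, hH⟩ : ∃ H, H = conj h := ⟨_, rfl⟩
  obtain ⟨k, hkdef⟩ : ∃ k, k = conj κ := ⟨_, rfl⟩
  obtain ⟨b, hb⟩ : ∃ b, b = conj a := ⟨_, rfl⟩
  rw [← hH, ← hkdef] at e1s e2s L11 L12
  rw [← hb] at L00 L01 L02 L11 L12 L01c hρ0 hb0 e10c
  rw [← hkdef] at hk0 e10c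
  rw [← hkdef, ← hb, ← hH] at hk
  rw [← hH] at hH0
  obtain ⟨ρ, hρ⟩ : ∃ ρ, ρ = 1 - b * a := ⟨_, rfl⟩
  rw [mul_comm a b] at L01c
  rw [← hρ] at L00 L01 L02 L11 L12 L01c hρ0
  obtain ⟨Δ, hΔ⟩ : ∃ Δ, Δ = κ * k - h * H := ⟨_, rfl⟩
  obtain ⟨t, ht⟩ : ∃ t, t = H + a * k := ⟨_, rfl⟩
  -- `Δ` and `t` are the cleared denominator and, up to sign, numerator of the eigenfunctions at
  -- `conj s = -H / k`.
  have hΔs : κ + h * -(H / k) = Δ / k := by rw [hΔ]; field_simp; ring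
  have hts : -(H / k) - a = -(t / k) := by rw [ht]; field_simp; ring
  rw [hΔs] at e1s e2s
  rw [hts] at e1s e2s
  have f1s : P * Δ = -(d 1 * t) := by field_simp at e1s; exact e1s
  have f2s : R * Δ ^ 2 = d 2 * t ^ 2 := by field_simp at e2s; exact e2s
  rw [e00, eq_div_iff hρ0] at L00
  rw [eq_div_iff (pow_ne_zero 2 hρ0)] at L01 L01c
  rw [eq_div_iff (pow_ne_zero 3 hρ0)] at L02
  have M11 : D₁ * (g10 * k - P) * ρ ^ 3 = H * k * (1 + b * a) := by
    field_simp at L11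
    linear_combination L11
  have M12 : D₁ * (g20 * k - R) * ρ ^ 4 = H * k * (b * (2 + b * a) + h * ρ * (1 + b * a)) := by
    field_simp at L12
    linear_combination L12
  refine gram_relations_inconsistent (a := a) (b := b) (h := h) (H := H) (d₀ := d 0) (D₀ := D₀)
    (d₁ := d 1) (D₁ := D₁) (d₂ := d 2) (κ := κ) (k := k) (ρ := ρ) (Δ := Δ) (t := t)
    (m := h * ρ + b) hκ hk hρ hΔ ht rfl ha0 hb0 h0 hH0 hκ0 hk0 L00 ?_ ?_ ?_ ?_ ?_
  · linear_combination (D₀ * ρ ^ 2) * e10 - κ * L01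
  · linear_combination (d 0 * ρ ^ 2) * e10c - k * L01c
  · linear_combination (-D₀ * ρ ^ 3) * e20 + κ ^ 2 * L02
  · linear_combination (κ * Δ) * M11 - (D₁ * k * Δ * ρ ^ 3) * e10 + (D₁ * κ * ρ ^ 3) * f1s
  · linear_combination (κ ^ 2 * Δ ^ 2) * M12 - (D₁ * k * Δ ^ 2 * ρ ^ 4) * e20
      + (D₁ * κ ^ 2 * ρ ^ 4) * f2s

end HardyDisc

theorem theorem4p1
    -- `φ` is a linear fractional self-map of the disc, given by the invertible matrix `A`
    (φ : HardyDisc.AnalyticSelfMap) (A : Matrix.GeneralLinearGroup (Fin 2) ℂ)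
    (hA : φ.IsGivenBy A)
    (hφ : ¬ φ.IsAutomorphism)
    (a : ℂ) (ha : a ∈ Metric.ball (0 : ℂ) 1) (ha0 : a ≠ 0) (hfix : φ a = a)
    (hC : IsComplexSymmetric (HardyDisc.compOp φ)) :
    A • (OnePoint.infty : OnePoint ℂ) = OnePoint.infty ∧
      ∃ p : Polynomial ℂ, p.natDegree = 1 ∧
        (∀ z : ℂ, A • (z : OnePoint ℂ) = ((p.eval z : ℂ) : OnePoint ℂ)) ∧
        ∀ z ∈ Metric.ball (0 : ℂ) 1, φ z = p.eval z := by
  have ha1 : ‖a‖ < 1 := by simpa using ha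
  obtain ⟨h, l, hl0, hl1, hlin, hpole⟩ := hA.exists_isLinearizedBy hφ ha1 hfix
  -- `h = 0` makes the lower left matrix entry vanish, so `φ` is affine.
  have hγ : A 1 0 = 0 := hpole (hlin.eq_zero_of_isComplexSymmetric ha1 ha0 hl0 hl1 hC)
  have hdet : A 0 0 * A 1 1 ≠ 0 := by
    have := A.det_ne_zero
    rwa [Matrix.det_fin_two, hγ, mul_zero, sub_zero] at this
  have hα : A 0 0 ≠ 0 := left_ne_zero_of_mul hdet
  have hδ : A 1 1 ≠ 0 := right_ne_zero_of_mul hdet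
  have heval (z : ℂ) : (Polynomial.C (A 0 0 / A 1 1) * Polynomial.X
      + Polynomial.C (A 0 1 / A 1 1)).eval z = (A 0 0 * z + A 0 1) / A 1 1 := by
    simp [add_div, div_mul_eq_mul_div]
  refine ⟨OnePoint.smul_infty_eq_self_iff.2 hγ, _,
    Polynomial.natDegree_linear (b := A 0 1 / A 1 1) (div_ne_zero hα hδ), fun z => ?_, fun z hz => ?_⟩
  · rw [OnePoint.smul_some_eq_ite, hγ, zero_mul, zero_add, if_neg hδ, heval]
  · rw [(hA.apply_eq (by simpa using hz)).2, hγ, zero_mul, zero_add, heval]
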